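/- All graphs are simple and undirected. For a graph $G=(V,E)$ of bounded degree (i.e. $\sup_{v\in V}\deg v<\infty$), let $A_G$ be its adjacency operator, the bounded self-adjoint operator on the complex Hilbert space $\ell^2(V)$ given by $(A_G\xi)(u)=\sum_{v:\{u,v\}\in E}\xi(v)$. For a bounded self-adjoint operator $X$ on a separable Hilbert space, with spectrum $\Sigma(X)\subset\mathbf R$, the local spectral measure $\mu_\xi$ of $X$ at a vector $\xi$ is the finite Borel measure on $\Sigma(X)$ with $\langle f(X)\xi\mid\xi\rangle=\int f\,d\mu_\xi$ for all continuous $f$. A vector $\xi$ is dominant if $\mu_\eta\ll\mu_\xi$ for every vector $\eta$, and a scalar-valued spectral measure of $X$ is a measure $\mu_\xi$ with $\xi$ dominant; it is unique up to equivalence of measures. By the Hahn–Hellinger theorem there is a measurable function $\mathfrak m\colon\Sigma(X)\to\{1,2,\dots,\infty\}$, unique up to equality $\mu$-almost everywhere, such that $X$ is unitarily equivalent to multiplication by $x$ on the space of those $f\in L^2(\Sigma(X),\mu;\ell^2)$ for which $f(x)$ lies in the span of the first $\mathfrak m(x)$ basis vectors of $\ell^2$ for $\mu$-almost every $x$. This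 $\mathfrak m$ is the spectral multiplicity function of $X$. The operator $X$ has uniform multiplicity $n$ if $\mathfrak m=n$ $\mu$-almost everywhere, and it is multiplicity-free if it has uniform multiplicity $1$. The marked spectrum of $G$ is the triple $(\Sigma(A_G),[\mu],\mathfrak m)$ for $X=A_G$, where $[\mu]$ is the equivalence class of $\mu$ and $\mathfrak m$ is taken up to equality $\mu$-almost everywhere. Let $R$ be the infinite ray, with vertex set $\mathbf N=\{0,1,2,\dots\}$ and edges $\{j,j+1\}$, $j\in\mathbf N$. Let $D_\infty$ be the graph obtained from $R$ by adding one vertex $0'$ and one edge $\{0',1\}$. Let $L$ be the infinite line, with vertex set $\mathbf Z$ and edges $\{j,j+1\}$, $j\in\mathbf Z$. **Proposition.** Let $G$ be an infinite connected graph of bounded degree with $\|A_G\|\le 2$. Then $\|A_G\|=2$, the spectrum of $A_G$ is $[-2,2]$, and one of the following holds: - $G$ is isomorphic to $R$, and $A_G$ is multiplicity-free and has no eigenvalue; - $G$ is isomorphic to $D_\infty$, and $A_G$ is multiplicity-free and has an eigenvalue; - $G$ is isomorphic to $L$, and $A_G$ is of uniform multiplicity two and has no eigenvalue. Moreover, each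 of the three graphs $R$, $D_\infty$, $L$ is determined by its marked spectrum among connected graphs of bounded degree: if $\Gamma$ is one of these three graphs and $G$ is a connected graph of bounded degree, finite or infinite, with the same marked spectrum as $\Gamma$, then $G$ is isomorphic to $\Gamma$. -/

import Mathlib

open MeasureTheory

open scoped ENNReal

namespace SpectralGraph

/-! ### The adjacency operator of a graph of bounded degree -/

section Adjacency

universe u

/-- A graph is of bounded degree if the numbers of neighbours of its vertices are bounded by a
common natural number. -/
def BoundedDegree {V : Type u} (G : SimpleGraph V) : Prop :=
  ∃ d : ℕ, ∀ v : V, (G.neighborSet v).encard ≤ d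

/-- The complex Hilbert space of square summable functions on `V`. -/
abbrev Ell2 (V : Type u) : Type u := lp (fun _ : V => ℂ) 2

/-- The function `u ↦ ∑_{v adjacent to u} ξ v`. -/
noncomputable def adjFun {V : Type u} (G : SimpleGraph V) (ξ : V → ℂ) (u : V) : ℂ :=
  ∑' v : G.neighborSet u, ξ v

theorem BoundedDegree.finite_neighborSet {V : Type u} {G : SimpleGraph V} (hG : BoundedDegree G)
    (u : V) : (G.neighborSet u).Finite := by
  obtain ⟨d, hd⟩ := hG
  exact Set.finite_of_encard_le_coe (hd u)

theorem adjFun_sum_le {V : Type u} {G : SimpleGraph V} {d : ℕ}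
    (hd : ∀ v : V, (G.neighborSet v).encard ≤ d) (ξ : Ell2 V) (s : Finset V) :
    ∑ u ∈ s, ‖adjFun G ξ u‖ ^ (2 : ℝ≥0∞).toReal ≤ (d * ‖ξ‖) ^ (2 : ℝ≥0∞).toReal := by
  classical
  have hfin : ∀ u, (G.neighborSet u).Finite := fun u => Set.finite_of_encard_le_coe (hd u)
  let N : V → Finset V := fun u => (hfin u).toFinset
  have hmem : ∀ u v, v ∈ N u ↔ G.Adj u v := by
    intro u v
    simp [N]
  have hcard : ∀ u, (N u).card ≤ d := by
    intro u
    have h := hd u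
    rw [(hfin u).encard_eq_coe_toFinset_card] at h
    exact_mod_cast h
  have hval : ∀ u, adjFun G ξ u = ∑ v ∈ N u, ξ v := by
    intro u
    have h := Finset.tsum_subtype (N u) (fun v => (ξ : V → ℂ) v)
    rw [← h]
    have hs : G.neighborSet u = {v | v ∈ N u} := by
      ext v
      simp [hmem]
    unfold adjFun
    rw [hs]
    rfl
  have htwo : (2 : ℝ≥0∞).toReal = ((2 : ℕ) : ℝ) := by norm_num
  simp only [htwo, Real.rpow_natCast]
  have h1 : ∀ u, ‖adjFun G ξ u‖ ^ 2 ≤ d * ∑ v ∈ N u, ‖ξ v‖ ^ 2 := by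
    intro u
    rw [hval u]
    calc ‖∑ v ∈ N u, ξ v‖ ^ 2 ≤ (∑ v ∈ N u, ‖ξ v‖) ^ 2 := by
          gcongr
          exact norm_sum_le _ _
      _ ≤ (N u).card * ∑ v ∈ N u, ‖ξ v‖ ^ 2 := sq_sum_le_card_mul_sum_sq
      _ ≤ d * ∑ v ∈ N u, ‖ξ v‖ ^ 2 := by
          have := hcard u
          gcongr
  have h2 : ∑ u ∈ s, ∑ v ∈ N u, ‖ξ v‖ ^ 2 ≤ d * ∑ v ∈ s.biUnion N, ‖ξ v‖ ^ 2 := by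
    have hcomm : ∑ u ∈ s, ∑ v ∈ N u, ‖ξ v‖ ^ 2
        = ∑ v ∈ s.biUnion N, ∑ u ∈ s.filter (fun u => v ∈ N u), ‖ξ v‖ ^ 2 := by
      apply Finset.sum_comm'
      intro u v
      simp only [Finset.mem_filter, Finset.mem_biUnion]
      constructor
      · rintro ⟨hu, hv⟩
        exact ⟨⟨hu, hv⟩, u, hu, hv⟩
      · rintro ⟨⟨hu, hv⟩, -⟩
        exact ⟨hu, hv⟩
    rw [hcomm, Finset.mul_sum]
    refine Finset.sum_le_sum fun v _ => ?_
    rw [Finset.sum_const, nsmul_eq_mul]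
    have hsub : s.filter (fun u => v ∈ N u) ⊆ N v := by
      intro u hu
      have := (Finset.mem_filter.mp hu).2
      rw [hmem] at this ⊢
      exact this.symm
    have : ((s.filter (fun u => v ∈ N u)).card : ℝ) ≤ d := by
      exact_mod_cast (Finset.card_le_card hsub).trans (hcard v)
    gcongr
  have h3 : ∑ v ∈ s.biUnion N, ‖ξ v‖ ^ 2 ≤ ‖ξ‖ ^ 2 := by
    have := lp.sum_rpow_le_norm_rpow (p := 2) (by norm_num) ξ (s.biUnion N)
    simpa only [htwo, Real.rpow_natCast] using this
  calc ∑ u ∈ s, ‖adjFun G ξ u‖ ^ 2 ≤ ∑ u ∈ s, d * ∑ v ∈ N u, ‖ξ v‖ ^ 2 :=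
        Finset.sum_le_sum fun u _ => h1 u
    _ = d * ∑ u ∈ s, ∑ v ∈ N u, ‖ξ v‖ ^ 2 := by rw [Finset.mul_sum]
    _ ≤ d * (d * ‖ξ‖ ^ 2) := by
        gcongr
        exact h2.trans (by gcongr)
    _ = (d * ‖ξ‖) ^ 2 := by ring

theorem adjFun_memℓp {V : Type u} {G : SimpleGraph V} (hG : BoundedDegree G) (ξ : Ell2 V) :
    Memℓp (adjFun G ξ) 2 := by
  obtain ⟨d, hd⟩ := hG
  exact memℓp_gen' (adjFun_sum_le hd ξ)

/-- The adjacency operator as a linear map on `ℓ²(V)`. -/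
noncomputable def adjacencyLinearMap {V : Type u} (G : SimpleGraph V) (hG : BoundedDegree G) :
    Ell2 V →ₗ[ℂ] Ell2 V where
  toFun ξ := ⟨adjFun G ξ, adjFun_memℓp hG ξ⟩
  map_add' ξ η := by
    ext u
    have := (hG.finite_neighborSet u).to_subtype
    exact Summable.tsum_add (f := fun v : G.neighborSet u => ξ v)
      (g := fun v : G.neighborSet u => η v) Summable.of_finite Summable.of_finite
  map_smul' c ξ := by
    ext u
    exact tsum_mul_left

/-- The adjacency operator `A_G` of a graph `G` of bounded degree, a bounded operator on `ℓ²(V)`: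
`(A_G ξ)(u) = ∑_{v adjacent to u} ξ v`. -/
noncomputable def adjacencyOperator {V : Type u} (G : SimpleGraph V) (hG : BoundedDegree G) :
    Ell2 V →L[ℂ] Ell2 V :=
  LinearMap.mkContinuousOfExistsBound (adjacencyLinearMap G hG) <| by
    have hG' := hG
    obtain ⟨d, hd⟩ := hG'
    exact ⟨d, fun ξ => lp.norm_le_of_forall_sum_le (by norm_num) (by positivity)
      (adjFun_sum_le hd ξ)⟩

theorem adjacencyOperator_apply {V : Type u} (G : SimpleGraph V) (hG : BoundedDegree G)
    (ξ : Ell2 V) (u : V) :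
    adjacencyOperator G hG ξ u = ∑' v : G.neighborSet u, ξ v := rfl

end Adjacency

/-! ### The three graphs -/

/-- The infinite ray `R`: vertex set `ℕ`, edges `{j, j + 1}`. -/
def infiniteRay : SimpleGraph ℕ :=
  SimpleGraph.fromRel fun i j => j = i + 1

/-- The infinite line `L`: vertex set `ℤ`, edges `{j, j + 1}`. -/
def infiniteLine : SimpleGraph ℤ :=
  SimpleGraph.fromRel fun i j => j = i + 1

/-- The oriented edges of `D_∞`; the vertex `none` is the additional vertex `0'`. -/
def dInftyRel : Option ℕ → Option ℕ → Prop
  | some i, some j => j = i + 1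
  | none, some j => j = 1
  | _, none => False

/-- The graph `D_∞`: the infinite ray with one more vertex `0'` and one more edge `{0', 1}`. -/
def dInfty : SimpleGraph (Option ℕ) :=
  SimpleGraph.fromRel dInftyRel

theorem encard_pair_le_two {α : Type*} (a b : α) : ({a, b} : Set α).encard ≤ (2 : ℕ) := by
  refine le_trans (Set.encard_insert_le _ _) ?_
  rw [Set.encard_singleton]
  norm_num

theorem boundedDegree_infiniteRay : BoundedDegree infiniteRay := by
  refine ⟨2, fun v => ?_⟩
  refine le_trans (Set.encard_le_encard (t := {v - 1, v + 1}) ?_) (encard_pair_le_two _ _)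
  intro w hw
  simp only [infiniteRay, SimpleGraph.mem_neighborSet, SimpleGraph.fromRel_adj] at hw
  simp only [Set.mem_insert_iff, Set.mem_singleton_iff]
  omega

theorem boundedDegree_infiniteLine : BoundedDegree infiniteLine := by
  refine ⟨2, fun v => ?_⟩
  refine le_trans (Set.encard_le_encard (t := {v - 1, v + 1}) ?_) (encard_pair_le_two _ _)
  intro w hw
  simp only [infiniteLine, SimpleGraph.mem_neighborSet, SimpleGraph.fromRel_adj] at hw
  simp only [Set.mem_insert_iff, Set.mem_singleton_iff]
  omega

theorem boundedDegree_dInfty : BoundedDegree dInfty := by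
  refine ⟨3, fun v => ?_⟩
  have key : dInfty.neighborSet v ⊆ {some (v.getD 0 - 1), some (v.getD 0 + 1), none} := by
    intro w hw
    simp only [dInfty, SimpleGraph.mem_neighborSet, SimpleGraph.fromRel_adj] at hw
    rcases v with _ | i <;> rcases w with _ | j <;> simp [dInftyRel] at hw ⊢ <;> omega
  refine le_trans (Set.encard_le_encard key) ?_
  refine le_trans (Set.encard_insert_le _ _) ?_
  calc _ ≤ (2 : ℕ∞) + 1 := by
        gcongr
        exact encard_pair_le_two _ _
    _ = ((3 : ℕ) : ℕ∞) := by norm_num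

/-! ### Spectral measures and multiplicities of bounded self-adjoint operators -/

section Spectral

universe u v

variable {H : Type u} [NormedAddCommGroup H] [InnerProductSpace ℂ H] [CompleteSpace H]
variable {K : Type v} [NormedAddCommGroup K] [InnerProductSpace ℂ K] [CompleteSpace K]

/-- `μ` is the local spectral measure at `ξ` of the self-adjoint operator `X`: the finite Borel
measure carried by the spectrum of `X` such that `⟨f(X) ξ | ξ⟩ = ∫ f dμ` for all continuous `f`. -/
structure IsLocalSpectralMeasure (X : H →L[ℂ] H) (ξ : H) (μ : Measure ℝ) : Prop where
  finite : IsFiniteMeasure μ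
  carried : μ (spectrum ℝ X)ᶜ = 0
  integral_eq : ∀ f : ℝ → ℝ, Continuous f →
    inner ℂ ξ (cfc f X ξ) = ((∫ x, f x ∂μ : ℝ) : ℂ)

/-- `ξ` is dominant for `X` if its local spectral measure dominates all the local spectral
measures of `X`. -/
def IsDominant (X : H →L[ℂ] H) (ξ : H) : Prop :=
  ∀ μ : Measure ℝ, IsLocalSpectralMeasure X ξ μ →
    ∀ (η : H) (ν : Measure ℝ), IsLocalSpectralMeasure X η ν → ν ≪ μ

/-- `μ` is a scalar-valued spectral measure of `X`: the local spectral measure of `X` at some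
dominant vector. -/
def IsScalarSpectralMeasure (X : H →L[ℂ] H) (μ : Measure ℝ) : Prop :=
  ∃ ξ : H, IsDominant X ξ ∧ IsLocalSpectralMeasure X ξ μ

/-- The space `L²(μ, m)` of (classes of) square integrable functions `f : ℝ → ℓ²` such that `f x`
lies in the span of the first `m x` basis vectors of `ℓ²` for almost all `x`; the coordinates are
numbered from `0`. -/
noncomputable def fieldL2 (μ : Measure ℝ) (m : ℝ → ℕ∞) : Submodule ℂ (Lp (Ell2 ℕ) 2 μ) where
  carrier := {f | ∀ᵐ x ∂μ, ∀ j : ℕ, m x ≤ (j : ℕ∞) → f x j = 0}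
  zero_mem' := by
    filter_upwards [Lp.coeFn_zero (Ell2 ℕ) 2 μ] with x hx j _
    rw [hx]
    rfl
  add_mem' := by
    intro f g hf hg
    simp only [Set.mem_ofPred_eq] at hf hg ⊢
    filter_upwards [Lp.coeFn_add f g, hf, hg] with x hx h1 h2 j hj
    rw [hx, Pi.add_apply, lp.coeFn_add, Pi.add_apply, h1 j hj, h2 j hj, add_zero]
  smul_mem' := by
    intro c f hf
    simp only [Set.mem_ofPred_eq] at hf ⊢
    filter_upwards [Lp.coeFn_smul c f, hf] with x hx h1 j hj
    rw [hx, Pi.smul_apply, lp.coeFn_smul, Pi.smul_apply, h1 j hj, smul_zero]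

/-- `X` is unitarily equivalent to the operator of multiplication by `x` on `L²(μ, m)`. -/
def UnitarilyEquivalentToMul (X : H →L[ℂ] H) (μ : Measure ℝ) (m : ℝ → ℕ∞) : Prop :=
  ∃ U : H ≃ₗᵢ[ℂ] fieldL2 μ m, ∀ ξ : H,
    ∀ᵐ x ∂μ, (U (X ξ) : Lp (Ell2 ℕ) 2 μ) x = (x : ℂ) • (U ξ : Lp (Ell2 ℕ) 2 μ) x

/-- `(S, [μ], m)` is the marked spectrum of the self-adjoint operator `X`: `S` is the spectrum
of `X`, `μ` is a scalar-valued spectral measure of `X`, and `m` is the spectral multiplicity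
function of `X`, a measurable function with values in `{1, 2, …, ∞}` on the spectrum such that `X`
is unitarily equivalent to multiplication by `x` on `L²(μ, m)`.  Measures on the spectrum are
seen as measures on `ℝ`, and only the values of `m` on the spectrum matter. -/
structure IsMarkedSpectrum (X : H →L[ℂ] H) (S : Set ℂ) (μ : Measure ℝ) (m : ℝ → ℕ∞) : Prop where
  spectrum_eq : spectrum ℂ X = S
  scalar : IsScalarSpectralMeasure X μ
  measurable : Measurable m
  one_le : ∀ x ∈ spectrum ℝ X, 1 ≤ m x
  unitary : UnitarilyEquivalentToMul X μ m

/-- `X` is of uniform multiplicity `n`: its spectral multiplicity function is equal to `n` almost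
everywhere. -/
def HasUniformMultiplicity (X : H →L[ℂ] H) (n : ℕ∞) : Prop :=
  ∃ (μ : Measure ℝ) (m : ℝ → ℕ∞), IsMarkedSpectrum X (spectrum ℂ X) μ m ∧ ∀ᵐ x ∂μ, m x = n

/-- `X` is multiplicity-free: its spectral multiplicity function is equal to `1` almost
everywhere. -/
def IsMultiplicityFree (X : H →L[ℂ] H) : Prop := HasUniformMultiplicity X 1

/-- `X` and `Y` have the same marked spectrum: the same spectrum, equivalent scalar-valued spectral
measures, and spectral multiplicity functions which are equal almost everywhere. -/
def SameMarkedSpectrum (X : H →L[ℂ] H) (Y : K →L[ℂ] K) : Prop :=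
  ∃ (S : Set ℂ) (μ ν : Measure ℝ) (m n : ℝ → ℕ∞),
    IsMarkedSpectrum X S μ m ∧ IsMarkedSpectrum Y S ν n ∧ μ ≪ ν ∧ ν ≪ μ ∧ m =ᵐ[μ] n

/-- The operator `X` has an eigenvalue. -/
def HasSomeEigenvalue (X : H →L[ℂ] H) : Prop :=
  ∃ z : ℂ, Module.End.HasEigenvalue (X : H →ₗ[ℂ] H) z

end Spectral

universe u w

/-- `G` is determined by its marked spectrum among connected graphs of bounded degree. -/
def DeterminedAmongConnected {V : Type u} (G : SimpleGraph V) (hG : BoundedDegree G) : Prop :=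
  ∀ (W : Type w) (G' : SimpleGraph W) (hG' : BoundedDegree G'), G'.Connected →
    SameMarkedSpectrum (adjacencyOperator G' hG') (adjacencyOperator G hG) →
    Nonempty (G' ≃g G)

end SpectralGraph

universe u w

namespace SpectralGraph

/-! ### Adjacency operators: point masses, self-adjointness, norms -/

section AdjacencyBasics

variable {V : Type u}

/-! The classification rests on a Perron–Frobenius type argument. If `f` is a nonzero, finitely
supported, nonnegative weight with `A f ≥ 2 f`, then `A f` also charges some vertex outside the
support, because the graph is infinite and connected; hence `‖A f‖ > 2 ‖f‖`. Such weights come from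
the affine Dynkin diagrams: the harmonic weights of D̃₄, Ẽ₈ and D̃ₙ are pushed forward along locally
injective maps into the graph, so the images of distinct vertices may coincide
(`two_lt_norm_of_weights`). In norm at most 2 this excludes a vertex of degree four, arms of lengths
1, 2, 5 at a branch point, and two branch points. With a branch point, an infinite graph provides a
long arm, the other two arms are single edges, and the graph is `dInfty`; without one it is the ray
or the line, according to whether there is a leaf.

Along a tail, truncated plane waves are approximate eigenvectors for every `x = 2 cos θ`, which
gives the spectrum `[-2, 2]` (`mem_spectrum_of_tail`). Square summable solutions of the eigenvalue
equation are killed by a conserved quadratic form (`eq_zero_of_recurrence`), whereas on `dInfty` the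
difference of the two leaves is a null vector.

Multiplication models are built by matching Gram matrices: the inner products of the vectors `X ^ k
ξ` are moments of local spectral measures, and moments determine measures and integrable densities
of bounded support. A leaf gives a cyclic vector for the ray and for `dInfty`. On the line, the even
vector `δ₀` and the odd vector `δ₁ - δ₋₁` generate orthogonal cyclic subspaces, with local measures
`μ` and `(4 - x²) μ`; as `μ` has no atom, these are equivalent and the multiplicity is two.

Conversely, a graph with the same marked spectrum as one of the three has norm at most 2, since the
norm of a self-adjoint operator is its spectral radius, and it is infinite, since its spectrum is.
It is therefore on the list. The existence of an eigenvalue, read off the atoms of the scalar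
measure, and the existence of a cyclic vector, read off the multiplicity, tell the three graphs
apart. -/

open Classical in
/-- The point mass at `v`, as a vector of `ℓ²(V)`. -/
noncomputable def delta (v : V) : Ell2 V := lp.single 2 v 1

theorem delta_apply_self (v : V) : (delta v : V → ℂ) v = 1 := by
  classical
  simp [delta]

theorem delta_apply_ne {u v : V} (h : u ≠ v) : (delta v : V → ℂ) u = 0 := by
  classical
  simp [delta, Pi.single_eq_of_ne h]

theorem inner_delta (v : V) (ξ : Ell2 V) : inner ℂ (delta v) ξ = ξ v := by
  classical
  simp [delta, lp.inner_single_left]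

theorem norm_delta (v : V) : ‖delta v‖ = 1 := by
  classical
  simp [delta, lp.norm_single]

open Classical in
/-- The finite set of the neighbours of `v`. -/
noncomputable def BoundedDegree.nb {G : SimpleGraph V} (hG : BoundedDegree G) (v : V) : Finset V :=
  (hG.finite_neighborSet v).toFinset

theorem BoundedDegree.mem_nb {G : SimpleGraph V} (hG : BoundedDegree G) {u v : V} :
    v ∈ hG.nb u ↔ G.Adj u v := by
  simp [BoundedDegree.nb]

theorem adjacencyOperator_apply_sum {G : SimpleGraph V} (hG : BoundedDegree G) (ξ : Ell2 V)
    (u : V) : adjacencyOperator G hG ξ u = ∑ v ∈ hG.nb u, ξ v := by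
  rw [adjacencyOperator_apply, ← Finset.tsum_subtype (hG.nb u) (fun v => (ξ : V → ℂ) v)]
  have hs : G.neighborSet u = {v | v ∈ hG.nb u} := by
    ext v
    simp [hG.mem_nb]
  rw [hs]
  rfl

theorem adjacencyOperator_apply_of_nb {G : SimpleGraph V} (hG : BoundedDegree G) (ξ : Ell2 V)
    (u : V) (s : Finset V) (hs : ∀ v, G.Adj u v ↔ v ∈ s) :
    adjacencyOperator G hG ξ u = ∑ v ∈ s, ξ v := by
  rw [adjacencyOperator_apply_sum]
  congr 1
  ext v
  rw [hG.mem_nb, hs]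

theorem adjacencyOperator_delta {G : SimpleGraph V} (hG : BoundedDegree G) (v : V) :
    adjacencyOperator G hG (delta v) = ∑ u ∈ hG.nb v, delta u := by
  classical
  ext u
  rw [adjacencyOperator_apply_sum, lp.coeFn_sum, Finset.sum_apply]
  by_cases h : G.Adj u v
  · trans 1
    · exact (Finset.sum_eq_single_of_mem (f := fun w => (delta v : V → ℂ) w) v (hG.mem_nb.2 h)
        (fun w _ hw => delta_apply_ne hw)).trans (delta_apply_self v)
    · exact ((Finset.sum_eq_single_of_mem (f := fun w => (delta w : V → ℂ) u) u (hG.mem_nb.2 h.symm)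
        (fun w _ hw => delta_apply_ne hw.symm)).trans (delta_apply_self u)).symm
  · rw [Finset.sum_eq_zero, Finset.sum_eq_zero]
    · intro w hw
      refine delta_apply_ne ?_
      rintro rfl
      exact h (hG.mem_nb.1 hw).symm
    · intro w hw
      refine delta_apply_ne ?_
      rintro rfl
      exact h (hG.mem_nb.1 hw)

theorem adjacencyOperator_delta_of_nb {G : SimpleGraph V} (hG : BoundedDegree G)
    (u : V) (s : Finset V) (hs : ∀ v, G.Adj u v ↔ v ∈ s) :
    adjacencyOperator G hG (delta u) = ∑ v ∈ s, delta v := by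
  rw [adjacencyOperator_delta]
  congr 1
  ext v
  rw [hG.mem_nb, hs]

theorem isSelfAdjoint_adjacencyOperator {G : SimpleGraph V} (hG : BoundedDegree G) :
    IsSelfAdjoint (adjacencyOperator G hG) := by
  rw [ContinuousLinearMap.isSelfAdjoint_iff']
  ext η u
  rw [← inner_delta, ContinuousLinearMap.adjoint_inner_right, adjacencyOperator_delta, sum_inner,
    adjacencyOperator_apply_sum]
  exact Finset.sum_congr rfl fun v _ => inner_delta v η

theorem sum_sq_norm_le (ξ : Ell2 V) (s : Finset V) : ∑ v ∈ s, ‖ξ v‖ ^ 2 ≤ ‖ξ‖ ^ 2 := by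
  have := lp.sum_rpow_le_norm_rpow (p := 2) (by norm_num) ξ s
  simpa using this

theorem norm_le_of_forall_sum_sq_le {ξ : Ell2 V} {C : ℝ} (hC : 0 ≤ C)
    (h : ∀ s : Finset V, ∑ v ∈ s, ‖ξ v‖ ^ 2 ≤ C ^ 2) : ‖ξ‖ ≤ C := by
  refine lp.norm_le_of_forall_sum_le (p := 2) (by norm_num) hC fun s => ?_
  simpa using h s

theorem norm_sq_sum_smul_delta (s : Finset V) (c : V → ℂ) :
    ‖∑ v ∈ s, c v • delta v‖ ^ 2 = ∑ v ∈ s, ‖c v‖ ^ 2 := by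
  classical
  have := lp.norm_sum_single (E := fun _ : V => ℂ) (p := 2) (by norm_num) c s
  have h2 : ∀ v, c v • delta v = lp.single 2 v (c v) := by
    intro v
    rw [delta, ← lp.single_smul, smul_eq_mul, mul_one]
  simp only [h2]
  simpa using this

/-- Coordinates of a square summable vector along an injective sequence tend to zero. -/
theorem tendsto_apply_of_injective (ξ : Ell2 V) {ι : Type*} {q : ι → V}
    (hq : Function.Injective q) :
    Filter.Tendsto (fun n => ξ (q n)) Filter.cofinite (nhds 0) := by
  have h := (lp.memℓp ξ).summable (p := 2) (by norm_num)
  have h1 := (h.comp_injective hq).tendsto_cofinite_zero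
  rw [tendsto_zero_iff_norm_tendsto_zero]
  have h2 := h1.sqrt
  simpa [Function.comp_def] using h2

/-- Schur's test. -/
theorem norm_adjacencyOperator_le_two_of_weight {G : SimpleGraph V} (hG : BoundedDegree G)
    (h : V → ℝ) (hpos : ∀ v, 0 < h v) (hle : ∀ u, ∑ v ∈ hG.nb u, h v ≤ 2 * h u) :
    ‖adjacencyOperator G hG‖ ≤ 2 := by
  classical
  refine ContinuousLinearMap.opNorm_le_bound _ (by norm_num) fun ξ => ?_
  refine norm_le_of_forall_sum_sq_le (by positivity) fun s => ?_
  have h1 : ∀ u, ‖adjacencyOperator G hG ξ u‖ ^ 2 ≤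
      2 * h u * ∑ v ∈ hG.nb u, ‖ξ v‖ ^ 2 / h v := by
    intro u
    rw [adjacencyOperator_apply_sum]
    calc ‖∑ v ∈ hG.nb u, ξ v‖ ^ 2 ≤ (∑ v ∈ hG.nb u, ‖ξ v‖) ^ 2 := by
          gcongr
          exact norm_sum_le _ _
      _ ≤ (∑ v ∈ hG.nb u, h v) * ∑ v ∈ hG.nb u, ‖ξ v‖ ^ 2 / h v := by
          -- Cauchy–Schwarz after writing `‖ξ v‖` as the product of `√(h v)` and `‖ξ v‖ / √(h v)`.
          refine Finset.sum_sq_le_sum_mul_sum_of_sq_le_mul _ (fun v _ => (hpos v).le)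
            (fun v _ => div_nonneg (by positivity) (hpos v).le) fun v _ => ?_
          rw [mul_div_cancel₀ _ (hpos v).ne']
      _ ≤ _ := by
          refine mul_le_mul_of_nonneg_right (hle u) (Finset.sum_nonneg fun v _ =>
            div_nonneg (by positivity) (hpos v).le)
  have hcomm : ∑ u ∈ s, ∑ v ∈ hG.nb u, 2 * h u * (‖ξ v‖ ^ 2 / h v)
      = ∑ v ∈ s.biUnion hG.nb, ∑ u ∈ s.filter (fun u => v ∈ hG.nb u),
        2 * h u * (‖ξ v‖ ^ 2 / h v) := by
    apply Finset.sum_comm'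
    intro u v
    simp only [Finset.mem_filter, Finset.mem_biUnion]
    constructor
    · rintro ⟨hu, hv⟩
      exact ⟨⟨hu, hv⟩, u, hu, hv⟩
    · rintro ⟨⟨hu, hv⟩, -⟩
      exact ⟨hu, hv⟩
  have h2 : ∀ v, ∑ u ∈ s.filter (fun u => v ∈ hG.nb u), 2 * h u * (‖ξ v‖ ^ 2 / h v)
      ≤ 4 * ‖ξ v‖ ^ 2 := by
    intro v
    rw [← Finset.sum_mul, ← Finset.mul_sum]
    have hsub : s.filter (fun u => v ∈ hG.nb u) ⊆ hG.nb v := by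
      intro u hu
      have := (Finset.mem_filter.mp hu).2
      rw [hG.mem_nb] at this ⊢
      exact this.symm
    have h3 := (Finset.sum_le_sum_of_subset_of_nonneg hsub
      (fun u _ _ => (hpos u).le)).trans (hle v)
    calc _ ≤ 2 * (2 * h v) * (‖ξ v‖ ^ 2 / h v) := by
          refine mul_le_mul_of_nonneg_right (by linarith) (div_nonneg (by positivity) (hpos v).le)
      _ = _ := by
          field_simp [(hpos v).ne']
          ring
  calc ∑ u ∈ s, ‖adjacencyOperator G hG ξ u‖ ^ 2
      ≤ ∑ u ∈ s, 2 * h u * ∑ v ∈ hG.nb u, ‖ξ v‖ ^ 2 / h v := Finset.sum_le_sum fun u _ => h1 u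
    _ = ∑ u ∈ s, ∑ v ∈ hG.nb u, 2 * h u * (‖ξ v‖ ^ 2 / h v) := by
        simp only [Finset.mul_sum]
    _ ≤ ∑ v ∈ s.biUnion hG.nb, 4 * ‖ξ v‖ ^ 2 := by
        rw [hcomm]
        exact Finset.sum_le_sum fun v _ => h2 v
    _ ≤ (2 * ‖ξ‖) ^ 2 := by
        rw [← Finset.mul_sum]
        linarith [sum_sq_norm_le ξ (s.biUnion hG.nb)]

/-- In a connected graph, a nonempty set of vertices which is closed under adjacency contains all
vertices. -/
theorem eq_univ_of_closed {G : SimpleGraph V} (hc : G.Connected) {S : Set V} (hne : S.Nonempty)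
    (hS : ∀ s ∈ S, ∀ t, G.Adj s t → t ∈ S) : S = Set.univ := by
  obtain ⟨o, ho⟩ := hne
  refine Set.eq_univ_of_forall fun v => ?_
  obtain ⟨p⟩ := hc.preconnected o v
  induction p with
  | nil => exact ho
  | cons h p ih => exact ih (hS _ ho _ h)

theorem exists_adj_not_mem [Infinite V] {G : SimpleGraph V} (hc : G.Connected) (S : Finset V)
    (hne : S.Nonempty) : ∃ s ∈ S, ∃ t, G.Adj s t ∧ t ∉ S := by
  by_contra! h
  have h1 : (S : Set V) = Set.univ := eq_univ_of_closed hc hne fun s hs t hst => h s hs t hst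
  exact Set.infinite_univ (h1 ▸ S.finite_toSet)

/-- A nonnegative subharmonic vector with finite support forces `‖A‖ > 2`. -/
theorem two_lt_norm_adjacencyOperator [Infinite V] {G : SimpleGraph V} (hG : BoundedDegree G)
    (hc : G.Connected) (f : V → ℝ) (hf : f.support.Finite) (h0 : ∀ v, 0 ≤ f v) (hne : ∃ v, f v ≠ 0)
    (hsub : ∀ u, 2 * f u ≤ ∑ v ∈ hG.nb u, f v) : 2 < ‖adjacencyOperator G hG‖ := by
  classical
  by_contra! hle
  let S := hf.toFinset
  have hS : ∀ v, v ∈ S ↔ f v ≠ 0 := fun v => by simp [S]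
  obtain ⟨v₀, hv₀⟩ := hne
  obtain ⟨s, hs, t, hst, ht⟩ := exists_adj_not_mem hc S ⟨v₀, (hS v₀).2 hv₀⟩
  let ξ : Ell2 V := ∑ v ∈ S, (f v : ℂ) • delta v
  have hξ : ∀ v, ξ v = f v := by
    intro v
    simp only [ξ, lp.coeFn_sum, Finset.sum_apply, lp.coeFn_smul, Pi.smul_apply, smul_eq_mul]
    by_cases hv : v ∈ S
    · rw [Finset.sum_eq_single_of_mem v hv (fun w _ hw => by rw [delta_apply_ne hw.symm, mul_zero]),
        delta_apply_self, mul_one]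
    · have hv' : f v = 0 := by
        by_contra h
        exact hv ((hS v).2 h)
      rw [hv', Finset.sum_eq_zero]
      · simp
      · intro w hw
        rw [delta_apply_ne, mul_zero]
        rintro rfl
        exact hv hw
  have hA : ∀ u, ‖adjacencyOperator G hG ξ u‖ = ∑ v ∈ hG.nb u, f v := by
    intro u
    rw [adjacencyOperator_apply_sum]
    simp only [hξ]
    rw [← Complex.ofReal_sum, Complex.norm_real, Real.norm_of_nonneg]
    exact Finset.sum_nonneg fun v _ => h0 v
  have h1 : ‖ξ‖ ^ 2 = ∑ v ∈ S, f v ^ 2 := by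
    rw [norm_sq_sum_smul_delta]
    simp
  -- The coordinates in `S` already contribute at least `4 ‖ξ‖²` to `‖A ξ‖²`; the vertex `t`,
  -- outside the support but adjacent to it, adds something positive.
  have h2 := sum_sq_norm_le (adjacencyOperator G hG ξ) (insert t S)
  rw [Finset.sum_insert ht] at h2
  have h3 : ∑ v ∈ S, 4 * f v ^ 2 ≤ ∑ v ∈ S, ‖adjacencyOperator G hG ξ v‖ ^ 2 := by
    refine Finset.sum_le_sum fun v _ => ?_
    rw [hA]
    nlinarith [hsub v, h0 v]
  have h4 : 0 < ‖adjacencyOperator G hG ξ t‖ ^ 2 := by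
    rw [hA]
    have : f s ≤ ∑ v ∈ hG.nb t, f v :=
      Finset.single_le_sum (fun v _ => h0 v) (hG.mem_nb.2 hst.symm)
    have : 0 < f s := lt_of_le_of_ne (h0 s) (Ne.symm ((hS s).1 hs))
    exact pow_pos (by linarith) 2
  have h5 : ‖adjacencyOperator G hG ξ‖ ≤ 2 * ‖ξ‖ :=
    (ContinuousLinearMap.le_opNorm _ _).trans (by gcongr)
  have h6 : ‖adjacencyOperator G hG ξ‖ ^ 2 ≤ (2 * ‖ξ‖) ^ 2 := by gcongr
  rw [← Finset.mul_sum] at h3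
  nlinarith

end AdjacencyBasics

/-! ### Subharmonic weights on locally injective images of the affine Dynkin diagrams -/

section Obstructions

variable {V : Type u}

open Classical in
/-- The indicator function of `{x}`. -/
noncomputable def pt (x u : V) : ℝ := if u = x then 1 else 0

open Classical in
/-- The indicator function of the set of the neighbours of `x`. -/
noncomputable def nbInd (G : SimpleGraph V) (x u : V) : ℝ := if G.Adj u x then 1 else 0

theorem pt_nonneg (x u : V) : 0 ≤ pt x u := by
  unfold pt
  split_ifs <;> norm_num

theorem pt_self (x : V) : pt x x = 1 := by simp [pt]

theorem sum_nb_pt {G : SimpleGraph V} (hG : BoundedDegree G) (x u : V) :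
    ∑ v ∈ hG.nb u, pt x v = nbInd G x u := by
  classical
  simp [pt, nbInd, hG.mem_nb]

theorem pt_le_nbInd {G : SimpleGraph V} {x a : V} (ha : G.Adj x a) (u : V) :
    pt a u ≤ nbInd G x u := by
  unfold pt nbInd
  by_cases h : u = a
  · subst h
    simp [ha.symm]
  · rw [if_neg h]
    split_ifs <;> norm_num

theorem pt_add_pt_le_nbInd {G : SimpleGraph V} {x a b : V} (ha : G.Adj x a) (hb : G.Adj x b)
    (hab : a ≠ b) (u : V) : pt a u + pt b u ≤ nbInd G x u := by
  by_cases h : u = b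
  · subst h
    have : pt a u = 0 := by simp [pt, hab.symm]
    rw [this, zero_add]
    exact pt_le_nbInd hb u
  · have : pt b u = 0 := by simp [pt, h]
    rw [this, add_zero]
    exact pt_le_nbInd ha u

theorem pt_add_pt_add_pt_le_nbInd {G : SimpleGraph V} {x a b c : V} (ha : G.Adj x a)
    (hb : G.Adj x b) (hc : G.Adj x c) (hab : a ≠ b) (hac : a ≠ c) (hbc : b ≠ c) (u : V) :
    pt a u + pt b u + pt c u ≤ nbInd G x u := by
  by_cases h : u = c
  · subst h
    have h1 : pt a u = 0 := by simp [pt, hac.symm]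
    have h2 : pt b u = 0 := by simp [pt, hbc.symm]
    rw [h1, h2, zero_add, zero_add]
    exact pt_le_nbInd hc u
  · have : pt c u = 0 := by simp [pt, h]
    rw [this, add_zero]
    exact pt_add_pt_le_nbInd ha hb hab u

theorem pt_add_pt_add_pt_add_pt_le_nbInd {G : SimpleGraph V} {x a b c d : V} (ha : G.Adj x a)
    (hb : G.Adj x b) (hc : G.Adj x c) (hd : G.Adj x d) (hab : a ≠ b) (hac : a ≠ c) (hbc : b ≠ c)
    (had : a ≠ d) (hbd : b ≠ d) (hcd : c ≠ d) (u : V) :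
    pt a u + pt b u + pt c u + pt d u ≤ nbInd G x u := by
  by_cases h : u = d
  · subst h
    have h1 : pt a u = 0 := by simp [pt, had.symm]
    have h2 : pt b u = 0 := by simp [pt, hbd.symm]
    have h3 : pt c u = 0 := by simp [pt, hcd.symm]
    rw [h1, h2, h3, zero_add, zero_add, zero_add]
    exact pt_le_nbInd hd u
  · have : pt d u = 0 := by simp [pt, h]
    rw [this, add_zero]
    exact pt_add_pt_add_pt_le_nbInd ha hb hc hab hac hbc u

/-- The weight `h` on a model diagram is pushed forward along `φ`, values adding up where `φ` is not
injective. By linearity the inequality `A f ≥ 2 f` can be checked on indicator functions, where it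
only matters that the neighbours of each vertex of the diagram have distinct images. -/
theorem two_lt_norm_of_weights [Infinite V] {G : SimpleGraph V} (hG : BoundedDegree G)
    (hc : G.Connected) {ι : Type*} (T : Finset ι) (φ : ι → V) (h : ι → ℝ) (h0 : ∀ t, 0 < h t)
    (hne : T.Nonempty)
    (hsub : ∀ u, 2 * ∑ t ∈ T, h t * pt (φ t) u ≤ ∑ t ∈ T, h t * nbInd G (φ t) u) :
    2 < ‖adjacencyOperator G hG‖ := by
  classical
  have hnn : ∀ v, ∀ t ∈ T, 0 ≤ h t * pt (φ t) v := fun v t _ => mul_nonneg (h0 t).le (pt_nonneg _ _)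
  refine two_lt_norm_adjacencyOperator hG hc (fun u => ∑ t ∈ T, h t * pt (φ t) u) ?_
    (fun v => Finset.sum_nonneg (hnn v)) ?_ fun u => ?_
  · refine (T.image φ).finite_toSet.subset fun u hu => ?_
    rw [Function.mem_support] at hu
    obtain ⟨t, ht, htu⟩ := Finset.exists_ne_zero_of_sum_ne_zero hu
    have : u = φ t := by
      by_contra hne
      simp [pt, hne] at htu
    rw [this]
    exact Finset.mem_coe.2 (Finset.mem_image_of_mem φ ht)
  · obtain ⟨t, ht⟩ := hne
    refine ⟨φ t, ne_of_gt ?_⟩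
    refine lt_of_lt_of_le ?_ (Finset.single_le_sum (hnn (φ t)) ht)
    rw [pt_self, mul_one]
    exact h0 t
  · refine (hsub u).trans (le_of_eq ?_)
    rw [Finset.sum_comm]
    simp only [← Finset.mul_sum, sum_nb_pt]

variable [Infinite V] {G : SimpleGraph V} (hG : BoundedDegree G) (hc : G.Connected)
  (hA : ‖adjacencyOperator G hG‖ ≤ 2)

-- The star with four leaves is D̃₄, and 2, 1, 1, 1, 1 is its harmonic weight: twice each value is
-- the sum of the values at the neighbours.
include hc hA in
theorem not_four_neighbors {o a b c d : V} (ha : G.Adj o a)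
    (hb : G.Adj o b) (hc' : G.Adj o c) (hd : G.Adj o d) (hab : a ≠ b) (hac : a ≠ c) (hbc : b ≠ c)
    (had : a ≠ d) (hbd : b ≠ d) (hcd : c ≠ d) : False := by
  refine (two_lt_norm_of_weights hG hc (Finset.univ : Finset (Fin 5)) ![o, a, b, c, d]
    ![2, 1, 1, 1, 1] ?_ Finset.univ_nonempty fun u => ?_).not_ge hA
  · intro t
    fin_cases t <;> norm_num
  · simp only [Fin.sum_univ_five]
    have h1 := pt_add_pt_add_pt_add_pt_le_nbInd ha hb hc' hd hab hac hbc had hbd hcd u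
    have h2 := pt_le_nbInd ha.symm u
    have h3 := pt_le_nbInd hb.symm u
    have h4 := pt_le_nbInd hc'.symm u
    have h5 := pt_le_nbInd hd.symm u
    simp
    linarith

-- This is Ẽ₈ with its harmonic weight: 6 at the centre, 3 on the short arm, 4, 2 on the middle arm,
-- and 5, 4, 3, 2, 1 on the long one. The arms need not be disjoint in the graph.
include hc hA in
theorem not_arms_one_two_five {o a a' b p₁ p₂ p₃ p₄ p₅ : V} (ha : G.Adj o a) (hb : G.Adj o b)
    (h1 : G.Adj o p₁) (hab : a ≠ b) (ha1 : a ≠ p₁) (hb1 : b ≠ p₁) (ha' : G.Adj a a')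
    (hoa : o ≠ a') (h2 : G.Adj p₁ p₂) (h3 : G.Adj p₂ p₃) (h4 : G.Adj p₃ p₄) (h5 : G.Adj p₄ p₅)
    (n1 : o ≠ p₂) (n2 : p₁ ≠ p₃) (n3 : p₂ ≠ p₄) (n4 : p₃ ≠ p₅) : False := by
  refine (two_lt_norm_of_weights hG hc (Finset.univ : Finset (Fin 9))
    ![o, a, a', b, p₁, p₂, p₃, p₄, p₅] ![6, 4, 2, 3, 5, 4, 3, 2, 1] ?_
    Finset.univ_nonempty fun u => ?_).not_ge hA
  · intro t
    fin_cases t <;> norm_num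
  · have i1 := pt_add_pt_add_pt_le_nbInd ha hb h1 hab ha1 hb1 u
    have i2 := pt_add_pt_le_nbInd ha.symm ha' hoa u
    have i3 := pt_le_nbInd ha'.symm u
    have i4 := pt_le_nbInd hb.symm u
    have i5 := pt_add_pt_le_nbInd h1.symm h2 n1 u
    have i6 := pt_add_pt_le_nbInd h2.symm h3 n2 u
    have i7 := pt_add_pt_le_nbInd h3.symm h4 n3 u
    have i8 := pt_add_pt_le_nbInd h4.symm h5 n4 u
    have i9 := pt_le_nbInd h5.symm u
    simp [Fin.sum_univ_succ]
    linarith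

-- The diagram is D̃ₙ₊₅: weight 2 along the path joining the branch points and 1 at the four outer
-- vertices. The path only has to be non-backtracking.
include hc hA in
theorem not_two_branch_points {a b c d : V} (n : ℕ) (p : ℕ → V)
    (hp : ∀ i, i ≤ n → G.Adj (p i) (p (i + 1))) (hpp : ∀ i, i < n → p i ≠ p (i + 2))
    (ha : G.Adj (p 0) a) (hb : G.Adj (p 0) b) (hab : a ≠ b) (ha1 : a ≠ p 1) (hb1 : b ≠ p 1)
    (hc' : G.Adj (p (n + 1)) c) (hd : G.Adj (p (n + 1)) d) (hcd : c ≠ d) (hcn : c ≠ p n)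
    (hdn : d ≠ p n) : False := by
  refine (two_lt_norm_of_weights hG hc ((Finset.range (n + 2)).disjSum (Finset.univ (α := Fin 4)))
    (Sum.elim p ![a, b, c, d]) (Sum.elim (fun _ => 2) (fun _ => 1)) ?_ ?_ fun u => ?_).not_ge hA
  · rintro (t | t) <;> norm_num
  · exact ⟨Sum.inl 0, by simp⟩
  -- Sum of the local inequalities along the path up to `p m`. Each path vertex is reached from both
  -- sides, except that `p 0` and `p m` are so far reached only once and `p (m + 1)` already once;
  -- this accounts for the correction terms.
  · have key : ∀ m, m ≤ n → pt a u + pt b u + 2 * ∑ i ∈ Finset.range (m + 1), pt (p i) u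
        - pt (p 0) u - pt (p m) u + pt (p (m + 1)) u
        ≤ ∑ i ∈ Finset.range (m + 1), nbInd G (p i) u := by
      intro m
      induction m with
      | zero =>
        intro _
        have := pt_add_pt_add_pt_le_nbInd ha hb (hp 0 (Nat.zero_le _)) hab ha1 hb1 u
        simp
        linarith
      | succ m ih =>
        intro hm
        have h1 := ih (by omega)
        have h2 := pt_add_pt_le_nbInd (hp m (by omega)).symm (hp (m + 1) hm) (hpp m (by omega)) u
        rw [Finset.sum_range_succ _ (m + 1), Finset.sum_range_succ _ (m + 1)]
        linarith
    have h1 := key n le_rfl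
    have h2 := pt_add_pt_add_pt_le_nbInd hc' hd (hp n le_rfl).symm hcd hcn hdn u
    have i1 := pt_le_nbInd ha.symm u
    have i2 := pt_le_nbInd hb.symm u
    have i3 := pt_le_nbInd hc'.symm u
    have i4 := pt_le_nbInd hd.symm u
    rw [Finset.sum_disjSum, Finset.sum_disjSum]
    simp only [Sum.elim_inl, Sum.elim_inr, ← Finset.mul_sum, Fin.sum_univ_four, one_mul]
    rw [Finset.sum_range_succ _ (n + 1), Finset.sum_range_succ _ (n + 1)]
    simp only [Matrix.cons_val]
    linarith

end Obstructions

/-! ### Infinite connected graphs of norm at most two -/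

section Classification

variable {V : Type u} [Infinite V] {G : SimpleGraph V}

/-- A vertex with at most two neighbours. -/
def AtMostTwoNeighbors (G : SimpleGraph V) (v : V) : Prop :=
  ∀ a b c, G.Adj v a → G.Adj v b → G.Adj v c → a = b ∨ a = c ∨ b = c

/-- The invariant of the greedy construction of a ray: all the vertices of `S` other than its last
vertex `v` have all their neighbours in `S`. -/
structure RayState (G : SimpleGraph V) (o : V) (F : Finset V) (S : Finset V) (v : V) : Prop where
  base_mem : o ∈ S
  leaves_subset : F ⊆ S
  last_mem : v ∈ S
  last_ne : v ≠ o
  last_not_mem : v ∉ F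
  exists_prev : ∃ u ∈ S, G.Adj v u
  closed : ∀ s ∈ S, s ≠ v → ∀ t, G.Adj s t → t ∈ S

-- Some edge leaves the finite set `S`, and by closedness it starts at `v`. One neighbour of `v` is
-- already in `S`, so the new one saturates it.
open Classical in
theorem RayState.exists_next (hc : G.Connected) {o : V} {F : Finset V}
    (hdeg : ∀ v, v ∉ F → v ≠ o → AtMostTwoNeighbors G v) {S : Finset V} {v : V}
    (h : RayState G o F S v) :
    ∃ w, w ∉ S ∧ G.Adj v w ∧ RayState G o F (insert w S) w := by
  obtain ⟨s, hs, w, hsw, hw⟩ := exists_adj_not_mem hc S ⟨o, h.base_mem⟩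
  have hsv : s = v := by
    by_contra hne
    exact hw (h.closed s hs hne w hsw)
  subst hsv
  refine ⟨w, hw, hsw, Finset.mem_insert_of_mem h.base_mem,
    h.leaves_subset.trans (Finset.subset_insert _ _), Finset.mem_insert_self _ _, ?_, ?_,
    ⟨s, Finset.mem_insert_of_mem hs, hsw.symm⟩, ?_⟩
  · rintro rfl
    exact hw h.base_mem
  · exact fun hF => hw (h.leaves_subset hF)
  · intro s' hs' hne t hst
    have hs'' : s' ∈ S := Finset.mem_of_mem_insert_of_ne hs' hne
    by_cases hss : s' = s
    · subst hss
      obtain ⟨u, hu, hsu⟩ := h.exists_prev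
      rcases hdeg s' h.last_not_mem h.last_ne u w t hsu hsw hst with h1 | h1 | h1
      · exact absurd (h1 ▸ hu) hw
      · exact Finset.mem_insert_of_mem (h1 ▸ hu)
      · exact h1 ▸ Finset.mem_insert_self _ _
    · exact Finset.mem_insert_of_mem (h.closed s' hs'' hss t hst)

/-- `F` is the set of leaves hanging at `o`: empty for the ray, two leaves for `dInfty`. The greedy
path never stops because the graph is infinite, and together with `F` it is closed under adjacency,
hence is everything. -/
theorem exists_ray (hc : G.Connected) {o x : V} (hox : G.Adj o x) (F : Finset V) (hoF : o ∉ F)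
    (hxF : x ∉ F) (hF : ∀ a ∈ F, ∀ u, G.Adj a u → u = o) (ho : ∀ u, G.Adj o u → u = x ∨ u ∈ F)
    (hdeg : ∀ v, v ∉ F → v ≠ o → AtMostTwoNeighbors G v) :
    ∃ r : ℕ → V, Function.Injective r ∧ r 0 = o ∧ (∀ n, r n ∉ F) ∧ (∀ v, v ∈ F ∨ ∃ n, r n = v) ∧
      ∀ i j, G.Adj (r i) (r j) ↔ (j = i + 1 ∨ i = j + 1) := by
  classical
  have h0 : RayState G o F (insert x (insert o F)) x := by
    refine ⟨by simp, ?_, by simp, hox.ne', hxF, ⟨o, by simp, hox.symm⟩, ?_⟩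
    · intro a ha
      simp [ha]
    · intro s hs hsx t hst
      simp only [Finset.mem_insert] at hs ⊢
      rcases hs with rfl | rfl | hs
      · exact absurd rfl hsx
      · rcases ho t hst with h | h
        · exact Or.inl h
        · exact Or.inr (Or.inr h)
      · exact Or.inr (Or.inl (hF s hs t hst))
  choose! nx hnx1 hnx2 hnx3 using fun (S : Finset V) (v : V) (h : RayState G o F S v) =>
    h.exists_next hc hdeg
  let st : ℕ → Finset V × V := fun n => Nat.rec (insert x (insert o F), x)
    (fun _ p => (insert (nx p.1 p.2) p.1, nx p.1 p.2)) n
  have hst : ∀ n, RayState G o F (st n).1 (st n).2 := by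
    intro n
    induction n with
    | zero => exact h0
    | succ n ih => exact hnx3 _ _ ih
  have hS : ∀ n, (st (n + 1)).1 = insert (st (n + 1)).2 (st n).1 := fun n => rfl
  have hnew : ∀ n, (st (n + 1)).2 ∉ (st n).1 := fun n => hnx1 _ _ (hst n)
  have hadj : ∀ n, G.Adj (st n).2 (st (n + 1)).2 := fun n => hnx2 _ _ (hst n)
  have hmono : Monotone fun n => (st n).1 := monotone_nat_of_le_succ fun n => by
    rw [hS]
    exact Finset.subset_insert _ _
  -- The index is shifted by one: `r 0` is the base `o` and `r (n + 1)` is the last vertex of stage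
  -- `n`, so stage `n` contains `r 0, …, r (n + 1)`.
  let r : ℕ → V := fun n => Nat.casesOn n o fun k => (st k).2
  have hr0 : r 0 = o := rfl
  have hr1 : ∀ n, r (n + 1) = (st n).2 := fun n => rfl
  have hrmem : ∀ i n, i ≤ n + 1 → r i ∈ (st n).1 := by
    intro i n hi
    rcases i with _ | i
    · exact (hst n).base_mem
    · exact hmono (by omega : i ≤ n) (hst i).last_mem
  have hrnew : ∀ n, r (n + 2) ∉ (st n).1 := fun n => hnew n
  have hlt : ∀ i j, i < j → r i ≠ r j := by
    intro i j hij heq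
    rcases j with _ | _ | j
    · omega
    · have : i = 0 := by omega
      subst this
      exact (hst 0).last_ne heq.symm
    · exact hrnew j (heq ▸ hrmem i j (by omega))
  have hradj : ∀ n, G.Adj (r n) (r (n + 1)) := by
    intro n
    rcases n with _ | n
    · exact hox
    · exact hadj n
  -- No chords: when a vertex of index `j + 2` is added, all those of index at most `j` are
  -- saturated.
  have hfar : ∀ i j, i + 1 < j → ¬ G.Adj (r i) (r j) := by
    intro i j hij hG
    rcases j with _ | _ | j
    · omega
    · omega
    · have hne : r i ≠ (st j).2 := by
        rw [← hr1]
        exact hlt i (j + 1) (by omega)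
      exact hrnew j ((hst j).closed (r i) (hrmem i j (by omega)) hne _ hG)
  refine ⟨r, ?_, rfl, ?_, ?_, ?_⟩
  · intro i j h
    rcases lt_trichotomy i j with hij | hij | hij
    · exact absurd h (hlt i j hij)
    · exact hij
    · exact absurd h.symm (hlt j i hij)
  · intro n
    rcases n with _ | n
    · exact hoF
    · exact (hst n).last_not_mem
  · have hsub : ∀ n, ∀ v ∈ (st n).1, v ∈ F ∨ ∃ n, r n = v := by
      intro n
      induction n with
      | zero =>
        intro v hv
        have hv' : v = x ∨ v = o ∨ v ∈ F := by simpa [st] using hv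
        rcases hv' with rfl | rfl | h
        · exact Or.inr ⟨1, rfl⟩
        · exact Or.inr ⟨0, rfl⟩
        · exact Or.inl h
      | succ n ih =>
        intro v hv
        rw [hS, Finset.mem_insert] at hv
        rcases hv with rfl | hv
        · exact Or.inr ⟨n + 2, rfl⟩
        · exact ih v hv
    have huniv : (⋃ n, ((st n).1 : Set V)) = Set.univ := by
      refine eq_univ_of_closed hc ⟨o, Set.mem_iUnion.2 ⟨0, (hst 0).base_mem⟩⟩ ?_
      intro s hs t hadj
      obtain ⟨n, hn⟩ := Set.mem_iUnion.1 hs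
      refine Set.mem_iUnion.2 ⟨n + 1, (hst (n + 1)).closed s (hmono n.le_succ hn) ?_ t hadj⟩
      rintro rfl
      exact hnew n hn
    intro v
    obtain ⟨n, hn⟩ := Set.mem_iUnion.1 (huniv ▸ Set.mem_univ v : v ∈ ⋃ n, ((st n).1 : Set V))
    exact hsub n v hn
  · intro i j
    constructor
    · intro h
      rcases lt_trichotomy i j with hij | hij | hij
      · left
        by_contra hne
        exact hfar i j (by omega) h
      · subst hij
        exact absurd h G.irrefl
      · right
        by_contra hne
        exact hfar j i (by omega) h.symm
    · rintro (rfl | rfl)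
      · exact hradj i
      · exact (hradj j).symm

theorem nonempty_iso_infiniteRay (hc : G.Connected) {o x : V} (hox : G.Adj o x)
    (ho : ∀ u, G.Adj o u → u = x) (hdeg : ∀ v, AtMostTwoNeighbors G v) :
    Nonempty (G ≃g infiniteRay) := by
  obtain ⟨r, hinj, -, -, hsurj, hadj⟩ := exists_ray hc hox ∅ (by simp) (by simp) (by simp)
    (fun u hu => Or.inl (ho u hu)) (fun v _ _ => hdeg v)
  have hbij : Function.Bijective r := ⟨hinj, fun v => (hsurj v).resolve_left (by simp)⟩
  refine ⟨SimpleGraph.Iso.symm ⟨Equiv.ofBijective r hbij, ?_⟩⟩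
  intro i j
  simp only [Equiv.ofBijective_apply, hadj, infiniteRay, SimpleGraph.fromRel_adj]
  omega

theorem nonempty_iso_dInfty (hc : G.Connected) {o x a b : V} (hox : G.Adj o x) (hoa : G.Adj o a)
    (hob : G.Adj o b) (hab : a ≠ b) (hax : a ≠ x) (hbx : b ≠ x) (ha : ∀ u, G.Adj a u → u = o)
    (hb : ∀ u, G.Adj b u → u = o) (ho : ∀ u, G.Adj o u → u = x ∨ u = a ∨ u = b)
    (hdeg : ∀ v, v ≠ o → AtMostTwoNeighbors G v) :
    Nonempty (G ≃g dInfty) := by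
  classical
  obtain ⟨r, hinj, hr0, hrF, hsurj, hadj⟩ := exists_ray hc hox {a, b}
    (by simp [hoa.ne, hob.ne]) (by simp [hax.symm, hbx.symm])
    (by
      intro c hc' u hu
      simp only [Finset.mem_insert, Finset.mem_singleton] at hc'
      rcases hc' with rfl | rfl
      · exact ha u hu
      · exact hb u hu)
    (by simpa using ho) (fun v _ hv => hdeg v hv)
  simp only [Finset.mem_insert, Finset.mem_singleton, not_or] at hrF hsurj
  have hleaf : ∀ c, (∀ u, G.Adj c u → u = o) → G.Adj o c → ∀ n, G.Adj c (r n) ↔ n = 0 := by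
    intro c hc' hoc n
    constructor
    · intro h
      exact hinj ((hc' _ h).trans hr0.symm)
    · rintro rfl
      rw [hr0]
      exact hoc.symm
  have hleafa := hleaf a ha hoa
  have hleafb := hleaf b hb hob
  have hnab : ¬ G.Adj a b := fun h => hob.ne (ha b h).symm
  -- The leaves are `none` and `some 0`, so the ray starting at the branch point occupies `some 1,
  -- some 2, …`.
  let f : Option ℕ → V := fun i => Option.casesOn i b fun k => Nat.casesOn k a r
  have fnone : f none = b := rfl
  have fzero : f (some 0) = a := rfl
  have fsucc : ∀ n, f (some (n + 1)) = r n := fun n => rfl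
  have hbij : Function.Bijective f := by
    constructor
    · rintro (_ | _ | i) (_ | _ | j) h
      · rfl
      · exact absurd h hab.symm
      · exact absurd h.symm (hrF j).2
      · exact absurd h hab
      · rfl
      · exact absurd h.symm (hrF j).1
      · exact absurd h (hrF i).2
      · exact absurd h (hrF i).1
      · have : i = j := hinj h
        rw [this]
    · intro v
      rcases hsurj v with (h | h) | ⟨n, h⟩
      · exact ⟨some 0, h.symm⟩
      · exact ⟨none, h.symm⟩
      · exact ⟨some (n + 1), h⟩
  refine ⟨SimpleGraph.Iso.symm ⟨Equiv.ofBijective f hbij, ?_⟩⟩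
  intro i j
  rw [Equiv.ofBijective_apply, Equiv.ofBijective_apply]
  rcases i with _ | _ | i <;> rcases j with _ | _ | j <;>
    simp [fnone, fzero, fsucc, dInfty, dInftyRel, hleafa, hleafb, hadj, hnab, G.adj_comm b a,
      G.adj_comm (r _) a, G.adj_comm (r _) b]
  omega

/-- Every vertex has exactly two neighbours, so an oriented edge has a unique non-backtracking
continuation. This is a permutation of the oriented edges, and its integer powers trace a two-sided
walk. If the walk met itself it would run through a finite set closed under adjacency. -/
theorem nonempty_iso_infiniteLine (hc : G.Connected) (hdeg : ∀ v, AtMostTwoNeighbors G v)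
    (hleaf : ∀ o x, G.Adj o x → ∃ u, G.Adj o u ∧ u ≠ x) :
    Nonempty (G ≃g infiniteLine) := by
  classical
  let D := {p : V × V // G.Adj p.1 p.2}
  choose nx hnx1 hnx2 using fun d : D => hleaf d.1.2 d.1.1 d.2.symm
  have huniq : ∀ (d : D) (w : V), G.Adj d.1.2 w → w ≠ d.1.1 → w = nx d := by
    intro d w hw hne
    rcases hdeg d.1.2 d.1.1 w (nx d) d.2.symm hw (hnx1 d) with h | h | h
    · exact absurd h.symm hne
    · exact absurd h.symm (hnx2 d)
    · exact h
  let step : D → D := fun d => ⟨(d.1.2, nx d), hnx1 d⟩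
  let rev : D → D := fun d => ⟨(d.1.2, d.1.1), d.2.symm⟩
  -- Walking backwards inverts walking forwards: the inverse of `step` is its conjugate by reversal.
  have hrev : ∀ d, rev (step (rev (step d))) = d := by
    intro d
    have h : nx (rev (step d)) = d.1.1 := by
      symm
      exact huniq (rev (step d)) d.1.1 d.2.symm (hnx2 d).symm
    apply Subtype.ext
    simp only [rev, step] at h ⊢
    rw [h]
  let f : Equiv.Perm D := ⟨step, fun d => rev (step (rev d)), hrev, fun d => by
    have := congrArg rev (hrev (rev d))
    exact this⟩
  obtain ⟨o⟩ := hc.nonempty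
  obtain ⟨s, hs, t, hst, -⟩ := exists_adj_not_mem hc {o} ⟨o, by simp⟩
  let d₀ : D := ⟨(s, t), hst⟩
  let q : ℤ → V := fun n => ((f ^ n) d₀).1.1
  have hsucc : ∀ n : ℤ, (f ^ (n + 1)) d₀ = step ((f ^ n) d₀) := by
    intro n
    rw [add_comm, zpow_add, zpow_one]
    rfl
  have hq1 : ∀ n, q (n + 1) = ((f ^ n) d₀).1.2 := by
    intro n
    simp only [q, hsucc, step]
  have hq2 : ∀ n, q (n + 2) = nx ((f ^ n) d₀) := by
    intro n
    rw [show n + 2 = (n + 1) + 1 by ring, hq1, hsucc]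
  have hadj : ∀ n, G.Adj (q n) (q (n + 1)) := by
    intro n
    rw [hq1]
    exact ((f ^ n) d₀).2
  have hne2 : ∀ n, q n ≠ q (n + 2) := by
    intro n
    rw [hq2]
    exact (hnx2 _).symm
  have hnb : ∀ n t, G.Adj (q n) t → t = q (n - 1) ∨ t = q (n + 1) := by
    intro n t ht
    have h1 : G.Adj (q n) (q (n - 1)) := by simpa using (hadj (n - 1)).symm
    have h2 : q (n - 1) ≠ q (n + 1) := by
      have := hne2 (n - 1)
      rwa [show n - 1 + 2 = n + 1 by ring] at this
    rcases hdeg (q n) _ _ _ h1 (hadj n) ht with h | h | h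
    · exact absurd h h2
    · exact Or.inl h.symm
    · exact Or.inr h.symm
  -- Induction on the gap. If `q i` is met again, its neighbours `q (i + 1)` and `q (i + g + 2)`
  -- differ by the smaller case, hence are its only neighbours, and the segment in between is closed
  -- under adjacency.
  have hgap : ∀ (g : ℕ) (i : ℤ), q i ≠ q (i + g + 1) := by
    intro g
    induction g using Nat.strong_induction_on with
    | _ g ih =>
      intro i heq
      rcases g with _ | _ | g
      · have := hadj i
        simp only [Nat.cast_zero, add_zero] at heq
        rw [← heq] at this
        exact G.irrefl this
      · refine hne2 i (heq.trans ?_)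
        congr 1
        push_cast
        ring
      · have h1 : G.Adj (q i) (q (i + 1)) := hadj i
        have h2 : G.Adj (q i) (q (i + g + 2)) := by
          have := (hadj (i + g + 2)).symm
          rw [show i + g + 2 + 1 = i + ((g + 1 + 1 : ℕ) : ℤ) + 1 by push_cast; ring, ← heq] at this
          exact this
        have h3 : q (i + 1) ≠ q (i + g + 2) := by
          have := ih g (by omega) (i + 1)
          rwa [show i + 1 + g + 1 = i + g + 2 by ring] at this
        obtain ⟨s, hs, t, hst, ht⟩ := exists_adj_not_mem hc
          ((Finset.Icc i (i + g + 3)).image q) ⟨q i, Finset.mem_image_of_mem q (by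
            rw [Finset.mem_Icc]; constructor <;> omega)⟩
        apply ht
        have hend : ∀ t, G.Adj (q i) t → t ∈ (Finset.Icc i (i + g + 3)).image q := by
          intro t ht
          rcases hdeg (q i) _ _ _ h1 h2 ht with h | h | h
          · exact absurd h h3
          · rw [← h]
            exact Finset.mem_image_of_mem q (by rw [Finset.mem_Icc]; constructor <;> omega)
          · rw [← h]
            exact Finset.mem_image_of_mem q (by rw [Finset.mem_Icc]; constructor <;> omega)
        obtain ⟨k, hk, rfl⟩ := Finset.mem_image.1 hs
        rw [Finset.mem_Icc] at hk
        by_cases hki : k = i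
        · subst hki
          exact hend t hst
        by_cases hkj : k = i + g + 3
        · refine hend t ?_
          rw [heq, show i + ((g + 1 + 1 : ℕ) : ℤ) + 1 = k by rw [hkj]; push_cast; ring]
          exact hst
        · rcases hnb k t hst with h | h
          · rw [h]
            exact Finset.mem_image_of_mem q (by rw [Finset.mem_Icc]; constructor <;> omega)
          · rw [h]
            exact Finset.mem_image_of_mem q (by rw [Finset.mem_Icc]; constructor <;> omega)
  have hlt : ∀ i j, i < j → q i ≠ q j := by
    intro i j hij
    have := hgap (j - i - 1).toNat i
    rwa [show i + ((j - i - 1).toNat : ℤ) + 1 = j by omega] at this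
  have hinj : Function.Injective q := by
    intro i j h
    rcases lt_trichotomy i j with hij | hij | hij
    · exact absurd h (hlt i j hij)
    · exact hij
    · exact absurd h.symm (hlt j i hij)
  have hrange : Set.range q = Set.univ := by
    refine eq_univ_of_closed hc ⟨q 0, 0, rfl⟩ ?_
    rintro _ ⟨n, rfl⟩ t ht
    rcases hnb n t ht with h | h
    · exact ⟨_, h.symm⟩
    · exact ⟨_, h.symm⟩
  have hbij : Function.Bijective q := ⟨hinj, Set.range_eq_univ.1 hrange⟩
  refine ⟨SimpleGraph.Iso.symm ⟨Equiv.ofBijective q hbij, ?_⟩⟩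
  intro i j
  simp only [Equiv.ofBijective_apply, infiniteLine, SimpleGraph.fromRel_adj]
  constructor
  · intro h
    rcases hnb i _ h with h | h
    · have := hinj h
      omega
    · have := hinj h
      omega
  · rintro ⟨-, h | h⟩
    · rw [h]
      exact hadj i
    · rw [h]
      exact (hadj j).symm

omit [Infinite V] in
theorem finite_setOf_walk_length_le (hG : BoundedDegree G) (n : ℕ) (u : V) :
    {v | ∃ w : G.Walk u v, w.length ≤ n}.Finite := by
  induction n generalizing u with
  | zero =>
    refine (Set.finite_singleton u).subset ?_
    rintro v ⟨w, hw⟩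
    exact (SimpleGraph.Walk.eq_of_length_eq_zero (Nat.le_zero.1 hw)).symm
  | succ n ih =>
    refine ((Set.finite_singleton u).union ((hG.nb u).finite_toSet.biUnion fun x _ => ih x)).subset ?_
    rintro v ⟨w, hw⟩
    cases w with
    | nil => exact Or.inl rfl
    | cons h p =>
      refine Or.inr (Set.mem_biUnion (Finset.mem_coe.2 (hG.mem_nb.2 h)) ⟨p, ?_⟩)
      simpa using hw

omit [Infinite V] in
theorem exists_path_getVert (hc : G.Connected) {o v : V} (hov : v ≠ o) :
    ∃ (n : ℕ) (p : ℕ → V), p 0 = o ∧ p (n + 1) = v ∧ (∀ i ≤ n, G.Adj (p i) (p (i + 1))) ∧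
      (∀ i < n, p i ≠ p (i + 2)) ∧ ∃ w : G.Walk o v, w.length = n + 1 := by
  obtain ⟨w, hw⟩ := (hc.preconnected o v).exists_isPath
  have hpos : w.length ≠ 0 := fun h => hov (SimpleGraph.Walk.eq_of_length_eq_zero h).symm
  obtain ⟨n, hn⟩ := Nat.exists_eq_succ_of_ne_zero hpos
  refine ⟨n, w.getVert, w.getVert_zero, ?_, ?_, ?_, w, hn⟩
  · rw [← Nat.succ_eq_add_one, ← hn, w.getVert_length]
  · intro i hi
    exact w.adj_getVert_succ (by omega)
  · intro i hi h
    have := hw.getVert_injOn (show i ≤ w.length by omega) (show i + 2 ≤ w.length by omega) h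
    omega

omit [Infinite V] in
theorem exists_two_ne_of_three {o a b c : V} (ha : G.Adj o a) (hb : G.Adj o b) (hc : G.Adj o c)
    (hab : a ≠ b) (hac : a ≠ c) (hbc : b ≠ c) (x : V) :
    ∃ a b, G.Adj o a ∧ G.Adj o b ∧ a ≠ b ∧ a ≠ x ∧ b ≠ x := by
  by_cases h1 : a = x
  · subst h1
    exact ⟨b, c, hb, hc, hbc, hab.symm, hac.symm⟩
  by_cases h2 : b = x
  · subst h2
    exact ⟨a, c, ha, hc, hac, h1, hbc.symm⟩
  exact ⟨a, b, ha, hb, hab, h1, h2⟩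

theorem classification_of_norm_le_two (hG : BoundedDegree G) (hc : G.Connected)
    (hA : ‖adjacencyOperator G hG‖ ≤ 2) :
    Nonempty (G ≃g infiniteRay) ∨ Nonempty (G ≃g dInfty) ∨ Nonempty (G ≃g infiniteLine) := by
  classical
  by_cases hdeg : ∀ v, AtMostTwoNeighbors G v
  · by_cases hleaf : ∀ o x, G.Adj o x → ∃ u, G.Adj o u ∧ u ≠ x
    · exact Or.inr (Or.inr (nonempty_iso_infiniteLine hc hdeg hleaf))
    · push Not at hleaf
      obtain ⟨o, x, hox, ho⟩ := hleaf
      exact Or.inl (nonempty_iso_infiniteRay hc hox ho hdeg)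
  · right
    left
    unfold AtMostTwoNeighbors at hdeg
    push Not at hdeg
    obtain ⟨o, a₀, b₀, c₀, ha₀, hb₀, hc₀, hab₀, hac₀, hbc₀⟩ := hdeg
    -- Balls are finite, so some vertex is at distance at least six from the branch point; a path to
    -- it supplies the five edges of the long arm of Ẽ₈.
    obtain ⟨v, hv⟩ := (finite_setOf_walk_length_le hG 5 o).exists_notMem
    have hvo : v ≠ o := by
      rintro rfl
      exact hv ⟨SimpleGraph.Walk.nil, by simp⟩
    obtain ⟨n, p, hp0, -, hp, hpp, w, hw⟩ := exists_path_getVert hc hvo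
    have hn : 5 ≤ n := by
      by_contra hlt
      exact hv ⟨w, by omega⟩
    subst hp0
    obtain ⟨a, b, ha, hb, hab, hax, hbx⟩ :=
      exists_two_ne_of_three ha₀ hb₀ hc₀ hab₀ hac₀ hbc₀ (p 1)
    have hx := hp 0 (by omega)
    -- A further neighbour of `a` would give arms of lengths 1, 2 and 5 at the branch point.
    have hleaf : ∀ a b, G.Adj (p 0) a → G.Adj (p 0) b → a ≠ b → a ≠ p 1 → b ≠ p 1 →
        ∀ u, G.Adj a u → u = p 0 := by
      intro a b ha hb hab hax hbx u hu
      by_contra hne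
      exact not_arms_one_two_five hG hc hA ha hb hx hab hax hbx hu (Ne.symm hne) (hp 1 (by omega))
        (hp 2 (by omega)) (hp 3 (by omega)) (hp 4 (by omega)) (hpp 0 (by omega))
        (hpp 1 (by omega)) (hpp 2 (by omega)) (hpp 3 (by omega))
    refine nonempty_iso_dInfty hc hx ha hb hab hax hbx (hleaf a b ha hb hab hax hbx)
      (hleaf b a hb ha hab.symm hbx hax) ?_ ?_
    · intro u hu
      by_contra! h
      exact not_four_neighbors hG hc hA hx ha hb hu hax.symm hbx.symm hab h.1.symm h.2.1.symm
        h.2.2.symm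
    -- A second branch point, joined to the first by a path, would give a D̃ₙ: two neighbours off
    -- the path are available at each end.
    · intro z hz
      by_contra h
      unfold AtMostTwoNeighbors at h
      push Not at h
      obtain ⟨a₁, b₁, c₁, ha₁, hb₁, hc₁, hab₁, hac₁, hbc₁⟩ := h
      obtain ⟨m, r, hr0, hrm, hr, hrr, -⟩ := exists_path_getVert hc hz
      obtain ⟨a', b', ha', hb', hab', hax', hbx'⟩ :=
        exists_two_ne_of_three ha₀ hb₀ hc₀ hab₀ hac₀ hbc₀ (r 1)
      obtain ⟨c', d', hc', hd', hcd', hcx', hdx'⟩ :=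
        exists_two_ne_of_three ha₁ hb₁ hc₁ hab₁ hac₁ hbc₁ (r m)
      rw [← hr0] at ha' hb'
      rw [← hrm] at hc' hd'
      exact not_two_branch_points hG hc hA m r hr hrr ha' hb' hab' hax' hbx' hc' hd' hcd' hcx' hdx'

end Classification

/-! ### Moments of measures with bounded support -/

section Moments

/-- The measure is carried by a bounded set. -/
def BoundedSupport (μ : Measure ℝ) : Prop := ∃ r : ℝ, ∀ᵐ x ∂μ, |x| ≤ r

variable {μ : Measure ℝ} [IsFiniteMeasure μ]

omit [IsFiniteMeasure μ] in
theorem BoundedSupport.exists_bound (hμ : BoundedSupport μ) {E : Type*} [NormedAddCommGroup E]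
    {f : ℝ → E} (hf : Continuous f) : ∃ C, ∀ᵐ x ∂μ, ‖f x‖ ≤ C := by
  obtain ⟨r, hr⟩ := hμ
  obtain ⟨C, hC⟩ := (isCompact_Icc (a := -r) (b := r)).exists_bound_of_continuousOn hf.continuousOn
  exact ⟨C, hr.mono fun x hx => hC x (abs_le.1 hx)⟩

theorem BoundedSupport.memLp (hμ : BoundedSupport μ) {E : Type*} [NormedAddCommGroup E]
    {f : ℝ → E} (hf : Continuous f) (p : ℝ≥0∞) : MemLp f p μ := by
  obtain ⟨C, hC⟩ := hμ.exists_bound hf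
  exact MemLp.of_bound hf.aestronglyMeasurable C hC

theorem BoundedSupport.integrable (hμ : BoundedSupport μ) {E : Type*} [NormedAddCommGroup E]
    {f : ℝ → E} (hf : Continuous f) : Integrable f μ :=
  memLp_one_iff_integrable.1 (hμ.memLp hf 1)

omit [IsFiniteMeasure μ] in
theorem BoundedSupport.integrable_mul (hμ : BoundedSupport μ) {f g : ℝ → ℂ} (hf : Continuous f)
    (hg : Integrable g μ) : Integrable (fun x => f x * g x) μ := by
  obtain ⟨C, hC⟩ := hμ.exists_bound hf
  exact hg.bdd_mul hf.aestronglyMeasurable hC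

omit [IsFiniteMeasure μ] in
theorem integral_polynomial_mul (hμ : BoundedSupport μ) {g : ℝ → ℂ} (hg : Integrable g μ)
    (p : Polynomial ℝ) : ∫ x, ((p.eval x : ℝ) : ℂ) * g x ∂μ
      = ∑ k ∈ Finset.range (p.natDegree + 1), (p.coeff k : ℂ) * ∫ x, (x : ℂ) ^ k * g x ∂μ := by
  simp only [← integral_const_mul]
  rw [← integral_finsetSum]
  · refine integral_congr_ae (Filter.Eventually.of_forall fun x => ?_)
    simp only [Polynomial.eval_eq_sum_range]
    push_cast
    rw [Finset.sum_mul]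
    exact Finset.sum_congr rfl fun k _ => by ring
  · intro k _
    exact (hμ.integrable_mul (by fun_prop) hg).const_mul _

-- Weierstrass approximation on an interval carrying `μ`: the error is at most the uniform distance
-- times `∫ ‖g‖`.
omit [IsFiniteMeasure μ] in
theorem integral_continuous_mul_eq_zero (hμ : BoundedSupport μ) {g : ℝ → ℂ} (hg : Integrable g μ)
    (h : ∀ k : ℕ, ∫ x, (x : ℂ) ^ k * g x ∂μ = 0) {φ : ℝ → ℝ} (hφ : Continuous φ) :
    ∫ x, (φ x : ℂ) * g x ∂μ = 0 := by
  obtain ⟨r, hr⟩ := hμ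
  have hμ' : BoundedSupport μ := ⟨r, hr⟩
  rw [← norm_le_zero_iff]
  refine le_of_forall_pos_le_add fun ε hε => ?_
  set I := ∫ x, ‖g x‖ ∂μ with hI
  have hI0 : 0 ≤ I := integral_nonneg fun x => norm_nonneg _
  obtain ⟨p, hp⟩ := exists_polynomial_near_of_continuousOn (-r) r φ hφ.continuousOn
    (ε / (I + 1)) (by positivity)
  have h0 : ∫ x, ((p.eval x : ℝ) : ℂ) * g x ∂μ = 0 := by
    rw [integral_polynomial_mul hμ' hg]
    exact Finset.sum_eq_zero fun k _ => by rw [h k, mul_zero]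
  have hcφ : Continuous fun x : ℝ => (φ x : ℂ) := Complex.continuous_ofReal.comp hφ
  have hcp : Continuous fun x : ℝ => ((p.eval x : ℝ) : ℂ) :=
    Complex.continuous_ofReal.comp p.continuous
  have h1 : ∫ x, (φ x : ℂ) * g x ∂μ = ∫ x, ((φ x : ℂ) - ((p.eval x : ℝ) : ℂ)) * g x ∂μ := by
    simp only [sub_mul]
    rw [integral_sub (hμ'.integrable_mul hcφ hg)
      (hμ'.integrable_mul hcp hg), h0, sub_zero]
  rw [h1]
  calc ‖∫ x, ((φ x : ℂ) - ((p.eval x : ℝ) : ℂ)) * g x ∂μ‖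
      ≤ ∫ x, ε / (I + 1) * ‖g x‖ ∂μ := by
        refine norm_integral_le_of_norm_le (hg.norm.const_mul _) ?_
        filter_upwards [hr] with x hx
        rw [norm_mul]
        refine mul_le_mul_of_nonneg_right ?_ (norm_nonneg _)
        rw [← Complex.ofReal_sub, Complex.norm_real, Real.norm_eq_abs, abs_sub_comm]
        exact (hp x (abs_le.1 hx)).le
    _ = ε / (I + 1) * I := integral_const_mul _ _
    _ ≤ 0 + ε := by
        rw [div_mul_eq_mul_div, zero_add, div_le_iff₀ (by positivity)]
        nlinarith

omit [IsFiniteMeasure μ] in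
/-- An integrable function with vanishing moments vanishes. -/
theorem ae_eq_zero_of_moments (hμ : BoundedSupport μ) {g : ℝ → ℂ} (hg : Integrable g μ)
    (h : ∀ k : ℕ, ∫ x, (x : ℂ) ^ k * g x ∂μ = 0) : ∀ᵐ x ∂μ, g x = 0 := by
  refine ae_eq_zero_of_integral_contDiff_smul_eq_zero hg.locallyIntegrable fun φ hφ _ => ?_
  have := integral_continuous_mul_eq_zero hμ hg h hφ.continuous
  simpa [Complex.real_smul] using this

/-- Two finite measures with bounded supports and with the same moments are equal. -/
theorem measure_eq_of_moments {ν : Measure ℝ} [IsFiniteMeasure ν] (hμ : BoundedSupport μ)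
    (hν : BoundedSupport ν) (h : ∀ k : ℕ, ∫ x, x ^ k ∂μ = ∫ x, x ^ k ∂ν) : μ = ν := by
  obtain ⟨r, hr⟩ := hμ
  obtain ⟨s, hs⟩ := hν
  have hμ' : BoundedSupport μ := ⟨r, hr⟩
  have hν' : BoundedSupport ν := ⟨s, hs⟩
  have hpoly : ∀ p : Polynomial ℝ, ∫ x, p.eval x ∂μ = ∫ x, p.eval x ∂ν := by
    intro p
    simp only [Polynomial.eval_eq_sum_range]
    rw [integral_finsetSum, integral_finsetSum]
    · simp only [integral_const_mul, h]
    · exact fun k _ => hν'.integrable (by fun_prop)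
    · exact fun k _ => hμ'.integrable (by fun_prop)
  refine ext_of_forall_integral_eq_of_IsFiniteMeasure fun f => ?_
  rw [← sub_eq_zero, ← abs_nonpos_iff]
  refine le_of_forall_pos_le_add fun ε hε => ?_
  set M := μ.real Set.univ + ν.real Set.univ
  have hM : 0 ≤ M := by positivity
  obtain ⟨p, hp⟩ := exists_polynomial_near_of_continuousOn (-(max r s)) (max r s) f
    f.continuous.continuousOn (ε / (M + 1)) (by positivity)
  have key : ∀ (ρ : Measure ℝ) [IsFiniteMeasure ρ], (∀ᵐ x ∂ρ, |x| ≤ max r s) →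
      |∫ x, p.eval x ∂ρ - ∫ x, f x ∂ρ| ≤ ε / (M + 1) * ρ.real Set.univ := by
    intro ρ _ hρ
    have hρ' : BoundedSupport ρ := ⟨_, hρ⟩
    rw [← integral_sub (hρ'.integrable p.continuous) (hρ'.integrable f.continuous)]
    rw [← Real.norm_eq_abs]
    refine norm_integral_le_of_norm_le_const (μ := ρ) ?_
    filter_upwards [hρ] with x hx
    exact (hp x (abs_le.1 hx)).le
  have k1 := key μ (hr.mono fun x hx => hx.trans (le_max_left _ _))
  have k2 := key ν (hs.mono fun x hx => hx.trans (le_max_right _ _))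
  rw [hpoly p] at k1
  have : ε / (M + 1) * M ≤ ε := by
    rw [div_mul_eq_mul_div, div_le_iff₀ (by positivity)]
    nlinarith
  rw [abs_le] at k1 k2 ⊢
  have h3 : ε / (M + 1) * M = ε / (M + 1) * μ.real Set.univ + ε / (M + 1) * ν.real Set.univ := by
    rw [← mul_add]
  constructor <;> linarith

end Moments

/-! ### Local spectral measures -/

section LocalSpectralMeasure

variable {H : Type u} [NormedAddCommGroup H] [InnerProductSpace ℂ H] [CompleteSpace H]
variable {X : H →L[ℂ] H}

/-- Riesz–Markov for the positive functional `f ↦ ⟨f(X) ξ | ξ⟩` on the compact spectrum, followed by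
pushforward to `ℝ`. -/
theorem exists_isLocalSpectralMeasure (hX : IsSelfAdjoint X) (ξ : H) :
    ∃ μ, IsLocalSpectralMeasure X ξ μ := by
  have hK : CompactSpace (spectrum ℝ X) := isCompact_iff_compactSpace.1 (spectrum.isCompact X)
  let toC : CompactlySupportedContinuousMap (spectrum ℝ X) ℝ →ₗ[ℝ] C(spectrum ℝ X, ℝ) :=
    { toFun := fun f => f.toContinuousMap
      map_add' := fun f g => rfl
      map_smul' := fun c f => rfl }
  let Λ₀ : CompactlySupportedContinuousMap (spectrum ℝ X) ℝ →ₗ[ℝ] ℝ :=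
    { toFun := fun f => (inner ℂ ξ (cfcHom hX (toC f) ξ)).re
      map_add' := fun f g => by
        rw [map_add, map_add, add_apply, inner_add_right, Complex.add_re]
      map_smul' := fun c f => by
        rw [map_smul, map_smul, smul_apply, RCLike.real_smul_eq_coe_smul (K := ℂ),
          inner_smul_right]
        simp }
  let Λ : CompactlySupportedContinuousMap (spectrum ℝ X) ℝ →ₚ[ℝ] ℝ :=
    PositiveLinearMap.mk₀ Λ₀ fun f hf => by
      have h1 : 0 ≤ cfcHom hX (toC f) := cfcHom_nonneg_iff hX |>.2 hf
      rw [ContinuousLinearMap.nonneg_iff_isPositive] at h1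
      exact (RCLike.nonneg_iff.1 (h1.inner_nonneg_right ξ)).1
  let ρ := RealRMK.rieszMeasure Λ
  have hρ : ∀ f : CompactlySupportedContinuousMap (spectrum ℝ X) ℝ, ∫ x, f x ∂ρ = Λ f :=
    RealRMK.integral_rieszMeasure Λ
  have hfin : IsFiniteMeasure ρ := inferInstance
  refine ⟨ρ.map Subtype.val, inferInstance, ?_, ?_⟩
  · rw [Measure.map_apply measurable_subtype_coe (spectrum.isClosed X).measurableSet.compl]
    have : (Subtype.val : spectrum ℝ X → ℝ) ⁻¹' (spectrum ℝ X)ᶜ = ∅ := by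
      ext x
      simp
    rw [this, measure_empty]
  · intro f hf
    rw [integral_map measurable_subtype_coe.aemeasurable hf.aestronglyMeasurable]
    let fc : CompactlySupportedContinuousMap (spectrum ℝ X) ℝ :=
      ⟨⟨fun x => f x, hf.comp continuous_subtype_val⟩, HasCompactSupport.of_compactSpace _⟩
    have h1 : ∫ x : spectrum ℝ X, f x ∂ρ = Λ fc := hρ fc
    have h2 : cfc f X = cfcHom hX (toC fc) := by
      rw [cfc_apply f X hX hf.continuousOn]
      rfl
    rw [h1, h2]
    have h3 : (inner ℂ ξ (cfcHom hX (toC fc) ξ)).im = 0 := by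
      have hsa : IsSelfAdjoint (cfcHom hX (toC fc)) := by
        rw [← h2]
        exact cfc_predicate f X
      rw [ContinuousLinearMap.isSelfAdjoint_iff_isSymmetric] at hsa
      exact hsa.im_inner_self_apply ξ
    exact Complex.ext rfl h3

theorem IsLocalSpectralMeasure.boundedSupport {ξ : H} {μ : Measure ℝ}
    (h : IsLocalSpectralMeasure X ξ μ) : BoundedSupport μ := by
  refine ⟨‖X‖ * ‖(1 : H →L[ℂ] H)‖, ?_⟩
  have := h.carried
  rw [← mem_ae_iff] at this
  filter_upwards [this] with x hx
  exact spectrum.norm_le_norm_mul_of_mem hx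

theorem IsLocalSpectralMeasure.moment (hX : IsSelfAdjoint X) {ξ : H} {μ : Measure ℝ}
    (h : IsLocalSpectralMeasure X ξ μ) (k : ℕ) :
    inner ℂ ξ ((X ^ k) ξ) = ((∫ x, x ^ k ∂μ : ℝ) : ℂ) := by
  rw [← h.integral_eq (fun x => x ^ k) (by fun_prop), cfc_pow_id (R := ℝ) X k hX]

theorem IsLocalSpectralMeasure.unique (hX : IsSelfAdjoint X) {ξ : H} {μ ν : Measure ℝ}
    (hμ : IsLocalSpectralMeasure X ξ μ) (hν : IsLocalSpectralMeasure X ξ ν) : μ = ν := by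
  have := hμ.finite
  have := hν.finite
  refine measure_eq_of_moments hμ.boundedSupport hν.boundedSupport fun k => ?_
  have := (hμ.moment hX k).symm.trans (hν.moment hX k)
  exact_mod_cast this

end LocalSpectralMeasure

/-! ### Isometries between spaces with total families of equal Gram matrices -/

section Gram

variable {F H : Type*} [NormedAddCommGroup F] [InnerProductSpace ℂ F] [CompleteSpace F]
  [NormedAddCommGroup H] [InnerProductSpace ℂ H] [CompleteSpace H]

omit [CompleteSpace F] [CompleteSpace H] in
theorem norm_linearCombination_eq_of_gram {ι : Type*} {a : ι → F} {b : ι → H}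
    (hab : ∀ i j, inner ℂ (a i) (a j) = inner ℂ (b i) (b j)) (x : ι →₀ ℂ) :
    ‖Finsupp.linearCombination ℂ b x‖ = ‖Finsupp.linearCombination ℂ a x‖ := by
  have h : inner ℂ (Finsupp.linearCombination ℂ b x) (Finsupp.linearCombination ℂ b x)
      = inner ℂ (Finsupp.linearCombination ℂ a x) (Finsupp.linearCombination ℂ a x) := by
    simp only [Finsupp.linearCombination_apply, Finsupp.sum, sum_inner, inner_sum,
      inner_smul_left, inner_smul_right, hab]
  rw [← sq_eq_sq₀ (norm_nonneg _) (norm_nonneg _)]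
  rw [inner_self_eq_norm_sq_to_K, inner_self_eq_norm_sq_to_K] at h
  exact_mod_cast h

theorem topologicalClosure_span_eq_top {ι : Type*} {a : ι → F}
    (ha : ∀ f, (∀ i, inner ℂ (a i) f = 0) → f = 0) :
    (Submodule.span ℂ (Set.range a)).topologicalClosure = ⊤ := by
  rw [Submodule.topologicalClosure_eq_top_iff, Submodule.eq_bot_iff]
  intro f hf
  refine ha f fun i => ?_
  exact (Submodule.mem_orthogonal _ _).1 hf _ (Submodule.subset_span ⟨i, rfl⟩)

/-- Equal Gram matrices give equal norms of linear combinations, so `a i ↦ b i` is well defined and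
isometric on the span of `a`, which is dense by totality, and extends. -/
theorem exists_linearIsometry_of_gram {ι : Type*} {a : ι → F} {b : ι → H}
    (hab : ∀ i j, inner ℂ (a i) (a j) = inner ℂ (b i) (b j))
    (ha : ∀ f, (∀ i, inner ℂ (a i) f = 0) → f = 0) :
    ∃ U : F →ₗᵢ[ℂ] H, ∀ i, U (a i) = b i := by
  have hnorm := norm_linearCombination_eq_of_gram hab
  have hdense : DenseRange (Finsupp.linearCombination ℂ a) := by
    have h := topologicalClosure_span_eq_top ha
    rw [← Finsupp.range_linearCombination, ← Submodule.dense_iff_topologicalClosure_eq_top] at h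
    exact h
  let W := (Finsupp.linearCombination ℂ b).extendOfNorm (Finsupp.linearCombination ℂ a)
  have hW : ∀ x, W (Finsupp.linearCombination ℂ a x) = Finsupp.linearCombination ℂ b x :=
    fun x => LinearMap.extendOfNorm_eq hdense ⟨1, fun x => by rw [hnorm, one_mul]⟩ x
  refine ⟨⟨W.toLinearMap, fun y => ?_⟩, fun i => ?_⟩
  · refine hdense.induction_on (p := fun y => ‖W y‖ = ‖y‖) y
      (isClosed_eq (by fun_prop) (by fun_prop)) fun x => ?_
    rw [hW, hnorm]
  · have := hW (Finsupp.single i 1)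
    simpa using this

theorem exists_linearIsometryEquiv_of_gram {ι : Type*} {a : ι → F} {b : ι → H}
    (hab : ∀ i j, inner ℂ (a i) (a j) = inner ℂ (b i) (b j))
    (ha : ∀ f, (∀ i, inner ℂ (a i) f = 0) → f = 0)
    (hb : ∀ f, (∀ i, inner ℂ (b i) f = 0) → f = 0) :
    ∃ U : H ≃ₗᵢ[ℂ] F, ∀ i, U (b i) = a i := by
  obtain ⟨W, hW⟩ := exists_linearIsometry_of_gram hab ha
  -- The range of an isometry from a complete space is closed, and here it contains a total family.
  have hsurj : Function.Surjective W := by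
    have hclosed : IsClosed (LinearMap.range W.toLinearMap : Set H) := by
      have := W.isometry.isClosedEmbedding.isClosed_range
      rw [LinearMap.coe_range]
      exact this
    have hle : Submodule.span ℂ (Set.range b) ≤ LinearMap.range W.toLinearMap := by
      rw [Submodule.span_le]
      rintro _ ⟨i, rfl⟩
      exact ⟨a i, hW i⟩
    have htop := Submodule.topologicalClosure_minimal _ hle hclosed
    rw [topologicalClosure_span_eq_top hb, top_le_iff] at htop
    exact LinearMap.range_eq_top.1 htop
  refine ⟨(LinearIsometryEquiv.ofSurjective W hsurj).symm, fun i => ?_⟩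
  rw [LinearIsometryEquiv.symm_apply_eq]
  exact (hW i).symm

theorem inner_pow_apply_left {X : H →L[ℂ] H} (hX : IsSelfAdjoint X) (k : ℕ) (ξ η : H) :
    inner ℂ ((X ^ k) ξ) η = inner ℂ ξ ((X ^ k) η) := by
  have h := hX.pow k
  rw [ContinuousLinearMap.isSelfAdjoint_iff'] at h
  conv_lhs => rw [← h]
  rw [ContinuousLinearMap.adjoint_inner_left]

theorem inner_pow_apply_pow_apply {X : H →L[ℂ] H} (hX : IsSelfAdjoint X) (k l : ℕ) (ξ η : H) :
    inner ℂ ((X ^ k) ξ) ((X ^ l) η) = inner ℂ ξ ((X ^ (k + l)) η) := by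
  rw [inner_pow_apply_left hX, pow_add]
  rfl

end Gram

/-! ### The spaces `L²(μ, m)` -/

section FieldL2

variable {μ : Measure ℝ}

/-- An L²-convergent sequence has a subsequence converging almost everywhere, along which vanishing
coordinates persist. This makes the model complete, as the extension of isometries requires. -/
theorem isClosed_fieldL2 (m : ℝ → ℕ∞) : IsClosed (fieldL2 μ m : Set (Lp (Ell2 ℕ) 2 μ)) := by
  refine IsSeqClosed.isClosed fun f g hf hg => ?_
  have h1 := tendstoInMeasure_of_tendsto_Lp hg
  obtain ⟨ns, -, hns⟩ := h1.exists_seq_tendsto_ae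
  have h2 : ∀ k, ∀ᵐ x ∂μ, ∀ j : ℕ, m x ≤ (j : ℕ∞) → f k x j = 0 := hf
  have h3 := ae_all_iff.2 h2
  change ∀ᵐ x ∂μ, ∀ j : ℕ, m x ≤ (j : ℕ∞) → g x j = 0
  filter_upwards [hns, h3] with x hx h4 j hj
  have h5 : Filter.Tendsto (fun i => inner ℂ (delta j) (f (ns i) x)) Filter.atTop
      (nhds (inner ℂ (delta j) (g x))) := Filter.Tendsto.inner tendsto_const_nhds hx
  simp only [inner_delta] at h5
  refine tendsto_nhds_unique h5 ?_
  simp only [h4 _ j hj]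
  exact tendsto_const_nhds

theorem memLp_coord (f : Lp (Ell2 ℕ) 2 μ) (j : ℕ) : MemLp (fun x => (f x : ℕ → ℂ) j) 2 μ := by
  have := MemLp.const_inner (𝕜 := ℂ) (delta j) (Lp.memLp f)
  simpa only [inner_delta] using this

theorem memLp_smul_delta {φ : ℝ → ℂ} (hφ : MemLp φ 2 μ) (j : ℕ) :
    MemLp (fun x => φ x • (delta j : Ell2 ℕ)) 2 μ :=
  (ContinuousLinearMap.smulRight (1 : ℂ →L[ℂ] ℂ) (delta j : Ell2 ℕ)).comp_memLp' hφ

/-- The class of the function `x ↦ φ x e_j`, where `e_j` is a basis vector of `ℓ²`. -/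
noncomputable def coordLp (j : ℕ) (φ : ℝ → ℂ) (hφ : MemLp φ 2 μ) : Lp (Ell2 ℕ) 2 μ :=
  (memLp_smul_delta hφ j).toLp

theorem coordLp_apply (j : ℕ) {φ : ℝ → ℂ} (hφ : MemLp φ 2 μ) :
    ∀ᵐ x ∂μ, coordLp j φ hφ x = φ x • (delta j : Ell2 ℕ) :=
  (memLp_smul_delta hφ j).coeFn_toLp

theorem coordLp_mem {m : ℝ → ℕ∞} (j : ℕ) {φ : ℝ → ℂ} (hφ : MemLp φ 2 μ)
    (h : ∀ᵐ x ∂μ, m x ≤ (j : ℕ∞) → φ x = 0) : coordLp j φ hφ ∈ fieldL2 μ m := by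
  change ∀ᵐ x ∂μ, ∀ i : ℕ, m x ≤ (i : ℕ∞) → coordLp j φ hφ x i = 0
  filter_upwards [coordLp_apply j hφ, h] with x hx hm i hi
  rw [hx, lp.coeFn_smul, Pi.smul_apply, smul_eq_mul]
  by_cases hij : i = j
  · subst hij
    rw [hm hi, zero_mul]
  · rw [delta_apply_ne hij, mul_zero]

theorem inner_coordLp (j : ℕ) {φ : ℝ → ℂ} (hφ : MemLp φ 2 μ) (f : Lp (Ell2 ℕ) 2 μ) :
    inner ℂ (coordLp j φ hφ) f = ∫ x, (starRingEnd ℂ) (φ x) * f x j ∂μ := by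
  rw [L2.inner_def]
  refine integral_congr_ae ?_
  filter_upwards [coordLp_apply j hφ] with x hx
  rw [hx, inner_smul_left, inner_delta]

theorem integrable_coord_mul (f : Lp (Ell2 ℕ) 2 μ) {φ : ℝ → ℂ} (hφ : MemLp φ 2 μ) (j : ℕ) :
    Integrable (fun x => φ x * f x j) μ :=
  hφ.integrable_mul (memLp_coord f j)

theorem fieldL2_eq_of_coord {m : ℝ → ℕ∞} (f g : fieldL2 μ m)
    (h : ∀ j : ℕ, ∀ᵐ x ∂μ, (j : ℕ∞) < m x → (f : Lp (Ell2 ℕ) 2 μ) x j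
      = (g : Lp (Ell2 ℕ) 2 μ) x j) : f = g := by
  refine Subtype.ext (Lp.ext ?_)
  have hf : ∀ᵐ x ∂μ, ∀ j : ℕ, m x ≤ (j : ℕ∞) → (f : Lp (Ell2 ℕ) 2 μ) x j = 0 := f.2
  have hg : ∀ᵐ x ∂μ, ∀ j : ℕ, m x ≤ (j : ℕ∞) → (g : Lp (Ell2 ℕ) 2 μ) x j = 0 := g.2
  filter_upwards [ae_all_iff.2 h, hf, hg] with x h1 h2 h3
  ext j
  rcases lt_or_ge (j : ℕ∞) (m x) with h4 | h4
  · exact h1 j h4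
  · rw [h2 j h4, h3 j h4]

end FieldL2

/-! ### Multiplication models of self-adjoint operators -/

section Models

universe v

variable {H : Type u} [NormedAddCommGroup H] [InnerProductSpace ℂ H] [CompleteSpace H]
variable {X : H →L[ℂ] H} {μ : Measure ℝ} {m : ℝ → ℕ∞}

omit [CompleteSpace H] in
theorem model_pow {U : H ≃ₗᵢ[ℂ] fieldL2 μ m}
    (hU : ∀ ξ : H, ∀ᵐ x ∂μ, (U (X ξ) : Lp (Ell2 ℕ) 2 μ) x = (x : ℂ) • (U ξ : Lp (Ell2 ℕ) 2 μ) x)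
    (k : ℕ) (ξ : H) : ∀ᵐ x ∂μ, (U ((X ^ k) ξ) : Lp (Ell2 ℕ) 2 μ) x
      = ((x : ℂ) ^ k) • (U ξ : Lp (Ell2 ℕ) 2 μ) x := by
  induction k with
  | zero => exact Filter.Eventually.of_forall fun x => by simp
  | succ k ih =>
    rw [pow_succ']
    filter_upwards [hU ((X ^ k) ξ), ih] with x h1 h2
    rw [mul_apply_eq_comp, h1, h2, smul_smul, pow_succ']

omit [CompleteSpace H] in
theorem inner_coordLp_model_pow {U : H ≃ₗᵢ[ℂ] fieldL2 μ m}
    (hU : ∀ ξ : H, ∀ᵐ x ∂μ, (U (X ξ) : Lp (Ell2 ℕ) 2 μ) x = (x : ℂ) • (U ξ : Lp (Ell2 ℕ) 2 μ) x)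
    (k j : ℕ) (ξ : H) {φ : ℝ → ℂ} (hφ : MemLp φ 2 μ) :
    inner ℂ (coordLp j φ hφ) (U ((X ^ k) ξ) : Lp (Ell2 ℕ) 2 μ)
      = ∫ x, (x : ℂ) ^ k * ((starRingEnd ℂ) (φ x) * (U ξ : Lp (Ell2 ℕ) 2 μ) x j) ∂μ := by
  rw [inner_coordLp]
  refine integral_congr_ae ?_
  filter_upwards [model_pow hU k ξ] with x hx
  rw [hx, lp.coeFn_smul, Pi.smul_apply, smul_eq_mul]
  ring

/-- In the model, the local spectral measure at `η` has density `‖(U η) x‖²` with respect to `μ`,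
since both have the same moments. -/
theorem absolutelyContinuous_of_model (hX : IsSelfAdjoint X) [IsFiniteMeasure μ]
    (hμ : BoundedSupport μ) (hU : UnitarilyEquivalentToMul X μ m) {η : H} {ν : Measure ℝ}
    (hν : IsLocalSpectralMeasure X η ν) : ν ≪ μ := by
  obtain ⟨U, hU⟩ := hU
  have := hν.finite
  let f : Lp (Ell2 ℕ) 2 μ := U η
  have hf : Integrable (fun x => ‖f x‖ ^ 2) μ :=
    (memLp_two_iff_integrable_sq_norm (Lp.aestronglyMeasurable f)).1 (Lp.memLp f)
  let ν' := μ.withDensity fun x => ENNReal.ofReal (‖f x‖ ^ 2)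
  have hfin : IsFiniteMeasure ν' := isFiniteMeasure_withDensity_ofReal hf.2
  have hac : ν' ≪ μ := withDensity_absolutelyContinuous _ _
  have hbs : BoundedSupport ν' := by
    obtain ⟨r, hr⟩ := hμ
    exact ⟨r, hac.ae_le hr⟩
  have heq : ν = ν' := by
    refine measure_eq_of_moments hν.boundedSupport hbs fun k => ?_
    rw [integral_withDensity_eq_integral_toReal_smul₀ hf.aemeasurable.ennreal_ofReal
      (Filter.Eventually.of_forall fun x => ENNReal.ofReal_lt_top)]
    have h1 := hν.moment hX k
    rw [← U.inner_map_map, Submodule.coe_inner, L2.inner_def] at h1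
    have h2 : ∫ x, inner ℂ (f x) ((U ((X ^ k) η) : Lp (Ell2 ℕ) 2 μ) x) ∂μ
        = ((∫ x, (ENNReal.ofReal (‖f x‖ ^ 2)).toReal • x ^ k ∂μ : ℝ) : ℂ) := by
      rw [← integral_complex_ofReal]
      refine integral_congr_ae ?_
      filter_upwards [model_pow hU k η] with x hx
      rw [hx, inner_smul_right, inner_self_eq_norm_sq_to_K, ENNReal.toReal_ofReal (by positivity)]
      rw [smul_eq_mul, mul_comm, Complex.ofReal_mul, Complex.ofReal_pow, Complex.ofReal_pow]
      rfl
    have h3 := h1.symm.trans h2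
    exact_mod_cast h3
  rw [heq]
  exact hac

theorem isMarkedSpectrum_of_model (hX : IsSelfAdjoint X) (hm : Measurable m)
    (h1 : ∀ x ∈ spectrum ℝ X, 1 ≤ m x) (hU : UnitarilyEquivalentToMul X μ m) {ξ : H}
    (hξ : IsLocalSpectralMeasure X ξ μ) : IsMarkedSpectrum X (spectrum ℂ X) μ m := by
  refine ⟨rfl, ⟨ξ, ?_, hξ⟩, hm, h1, hU⟩
  intro μ' hμ' η ν hν
  have := hξ.finite
  rw [← hξ.unique hX hμ']
  exact absolutelyContinuous_of_model hX hξ.boundedSupport hU hν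

/-- A family of `n` vectors whose cyclic subspaces are orthogonal and span the space, and whose
local spectral measures are `s i ^ 2 μ`, gives a multiplication model of multiplicity `n`. -/
theorem unitarilyEquivalentToMul_of_family (hX : IsSelfAdjoint X) [IsFiniteMeasure μ]
    (hμ : BoundedSupport μ) (n : ℕ) (ξ : ℕ → H) (s : ℕ → ℝ → ℝ) (hs : ∀ i, Continuous (s i))
    (hs0 : ∀ i, ∀ᵐ x ∂μ, s i x ≠ 0)
    (hgram : ∀ i < n, ∀ j < n, ∀ k, inner ℂ (ξ i) ((X ^ k) (ξ j))
      = if i = j then ((∫ x, s i x ^ 2 * x ^ k ∂μ : ℝ) : ℂ) else 0)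
    (htot : ∀ η, (∀ i < n, ∀ k, inner ℂ ((X ^ k) (ξ i)) η = 0) → η = 0) :
    UnitarilyEquivalentToMul X μ fun _ => (n : ℕ∞) := by
  have hcomplete : CompleteSpace (fieldL2 μ fun _ => (n : ℕ∞)) :=
    (isClosed_fieldL2 _).completeSpace_coe
  have hφc : ∀ i k, Continuous fun x : ℝ => (s i x : ℂ) * (x : ℂ) ^ k := by
    intro i k
    have := hs i
    fun_prop
  have hφ : ∀ i k, MemLp (fun x : ℝ => (s i x : ℂ) * (x : ℂ) ^ k) 2 μ :=
    fun i k => hμ.memLp (hφc i k) 2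
  -- The vector `X ^ k (ξ i)` should correspond to the function `s i x · x ^ k` times the `i`-th
  -- basis vector.
  let a : Fin n × ℕ → fieldL2 μ fun _ => (n : ℕ∞) := fun p => ⟨coordLp p.1 _ (hφ p.1 p.2),
    coordLp_mem _ _ (Filter.Eventually.of_forall fun x hx => absurd hx
      (not_le.2 (by exact_mod_cast p.1.2)))⟩
  let b : Fin n × ℕ → H := fun p => (X ^ p.2) (ξ p.1)
  have ha : ∀ p f, inner ℂ (a p) f
      = ∫ x, (x : ℂ) ^ p.2 * ((s p.1 x : ℂ) * (f : Lp (Ell2 ℕ) 2 μ) x p.1) ∂μ := by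
    intro p f
    rw [Submodule.coe_inner, inner_coordLp]
    refine integral_congr_ae (Filter.Eventually.of_forall fun x => ?_)
    simp only [map_mul, map_pow, Complex.conj_ofReal]
    ring
  have hab : ∀ p q, inner ℂ (a p) (a q) = inner ℂ (b p) (b q) := by
    rintro ⟨i, k⟩ ⟨j, l⟩
    simp only [b]
    rw [inner_pow_apply_pow_apply hX, hgram i i.2 j j.2, ha]
    simp only [a]
    split_ifs with hij
    · rw [← integral_complex_ofReal]
      refine integral_congr_ae ?_
      filter_upwards [coordLp_apply (j : ℕ) (hφ j l)] with x hx
      rw [hx, lp.coeFn_smul, Pi.smul_apply, smul_eq_mul, hij, delta_apply_self]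
      push_cast
      ring
    · rw [← integral_zero ℝ ℂ (μ := μ)]
      refine integral_congr_ae ?_
      filter_upwards [coordLp_apply (j : ℕ) (hφ j l)] with x hx
      rw [hx, lp.coeFn_smul, Pi.smul_apply, smul_eq_mul, delta_apply_ne hij]
      ring
  have hint : ∀ (f : Lp (Ell2 ℕ) 2 μ) (i : ℕ) {c : ℝ → ℂ}, Continuous c →
      Integrable (fun x => c x * f x i) μ := fun f i c hc =>
    integrable_coord_mul f (hμ.memLp hc 2) i
  have hsc : ∀ i, Continuous fun x : ℝ => (s i x : ℂ) := fun i =>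
    Complex.continuous_ofReal.comp (hs i)
  have htota : ∀ f, (∀ p, inner ℂ (a p) f = 0) → f = 0 := by
    intro f hf
    refine fieldL2_eq_of_coord f 0 fun j => ?_
    by_cases hj : j < n
    · have h1 := ae_eq_zero_of_moments hμ (hint f j (hsc j))
        (fun k => by rw [← ha (⟨j, hj⟩, k), hf])
      filter_upwards [h1, hs0 j, Lp.coeFn_zero (Ell2 ℕ) 2 μ] with x hx h2 h3 _
      rw [Submodule.coe_zero, h3, Pi.zero_apply, lp.coeFn_zero, Pi.zero_apply]
      exact (mul_eq_zero.1 hx).resolve_left (by exact_mod_cast h2)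
    · exact Filter.Eventually.of_forall fun x hx => absurd (by exact_mod_cast hx) hj
  obtain ⟨U, hUab⟩ := exists_linearIsometryEquiv_of_gram hab htota
    (fun η hη => htot η fun i hi k => hη (⟨i, hi⟩, k))
  refine ⟨U, fun η => ?_⟩
  have hcoord : ∀ j : ℕ, j < n → ∀ᵐ x ∂μ, (U (X η) : Lp (Ell2 ℕ) 2 μ) x j
      = (x : ℂ) * (U η : Lp (Ell2 ℕ) 2 μ) x j := by
    intro j hj
    have hxs : Continuous fun x : ℝ => (x : ℂ) * (s j x : ℂ) :=
      Complex.continuous_ofReal.mul (hsc j)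
    -- Intertwining is proved weakly: all moments of `s j` times the `j`-th coordinate of `U (X η) -
    -- x U η` vanish, because self-adjointness moves `X` to the other side and raises `k` by one.
    -- Then `s j ≠ 0` almost everywhere is divided out.
    have h1 := ae_eq_zero_of_moments hμ ((hint (U (X η)) j (hsc j)).sub (hint (U η) j hxs))
      (fun k => by
        have e1 : inner ℂ (a (⟨j, hj⟩, k)) (U (X η)) = inner ℂ (a (⟨j, hj⟩, k + 1)) (U η) := by
          rw [← hUab, ← hUab, U.inner_map_map, U.inner_map_map]
          simp only [b]
          rw [inner_pow_apply_left hX, inner_pow_apply_left hX, pow_succ]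
          rfl
        rw [ha, ha] at e1
        simp only [Pi.sub_apply, mul_sub]
        rw [integral_sub, e1, sub_eq_zero]
        · refine integral_congr_ae (Filter.Eventually.of_forall fun x => ?_)
          simp only [pow_succ]
          ring
        · exact hμ.integrable_mul (by fun_prop) (hint _ _ (hsc j))
        · exact hμ.integrable_mul (by fun_prop) (hint _ _ hxs))
    filter_upwards [h1, hs0 j] with x hx h2
    have h3 : (s j x : ℂ) * ((U (X η) : Lp (Ell2 ℕ) 2 μ) x j
        - (x : ℂ) * (U η : Lp (Ell2 ℕ) 2 μ) x j) = 0 := by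
      rw [← hx, Pi.sub_apply]
      ring
    exact sub_eq_zero.1 ((mul_eq_zero.1 h3).resolve_left (by exact_mod_cast h2))
  have hz1 : ∀ᵐ x ∂μ, ∀ j : ℕ, (n : ℕ∞) ≤ (j : ℕ∞) → (U (X η) : Lp (Ell2 ℕ) 2 μ) x j = 0 :=
    (U (X η)).2
  have hz2 : ∀ᵐ x ∂μ, ∀ j : ℕ, (n : ℕ∞) ≤ (j : ℕ∞) → (U η : Lp (Ell2 ℕ) 2 μ) x j = 0 := (U η).2
  have hcoord' : ∀ᵐ x ∂μ, ∀ j : ℕ, j < n → (U (X η) : Lp (Ell2 ℕ) 2 μ) x j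
      = (x : ℂ) * (U η : Lp (Ell2 ℕ) 2 μ) x j := by
    rw [ae_all_iff]
    intro j
    by_cases hj : j < n
    · exact (hcoord j hj).mono fun x hx _ => hx
    · exact Filter.Eventually.of_forall fun x h => absurd h hj
  filter_upwards [hz1, hz2, hcoord'] with x h1 h2 h3
  ext j
  rw [lp.coeFn_smul, Pi.smul_apply, smul_eq_mul]
  by_cases hj : j < n
  · exact h3 j hj
  · have hj' : (n : ℕ∞) ≤ (j : ℕ∞) := by exact_mod_cast not_lt.1 hj
    rw [h1 j hj', h2 j hj', mul_zero]

theorem hasUniformMultiplicity_of_family (hX : IsSelfAdjoint X) (n : ℕ) (hn : 1 ≤ n) (ξ : ℕ → H)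
    (hξ : IsLocalSpectralMeasure X (ξ 0) μ) (s : ℕ → ℝ → ℝ) (hs : ∀ i, Continuous (s i))
    (hs0 : ∀ i, ∀ᵐ x ∂μ, s i x ≠ 0)
    (hgram : ∀ i < n, ∀ j < n, ∀ k, inner ℂ (ξ i) ((X ^ k) (ξ j))
      = if i = j then ((∫ x, s i x ^ 2 * x ^ k ∂μ : ℝ) : ℂ) else 0)
    (htot : ∀ η, (∀ i < n, ∀ k, inner ℂ ((X ^ k) (ξ i)) η = 0) → η = 0) :
    HasUniformMultiplicity X n := by
  have := hξ.finite
  refine ⟨μ, fun _ => (n : ℕ∞), ?_, Filter.Eventually.of_forall fun x => rfl⟩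
  exact isMarkedSpectrum_of_model hX measurable_const (fun x _ => by exact_mod_cast hn)
    (unitarilyEquivalentToMul_of_family hX hξ.boundedSupport n ξ s hs hs0 hgram htot) hξ

/-- `ξ` is a cyclic vector of the self-adjoint operator `X`. -/
def IsCyclicVector (X : H →L[ℂ] H) (ξ : H) : Prop :=
  ∀ η, (∀ k : ℕ, inner ℂ ((X ^ k) ξ) η = 0) → η = 0

theorem IsCyclicVector.isMultiplicityFree (hX : IsSelfAdjoint X) {ξ : H}
    (hξ : IsCyclicVector X ξ) : IsMultiplicityFree X := by
  obtain ⟨μ, hμ⟩ := exists_isLocalSpectralMeasure hX ξ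
  have h := hasUniformMultiplicity_of_family hX 1 le_rfl (fun _ => ξ) hμ (fun _ _ => 1)
    (fun _ => continuous_const) (fun _ => Filter.Eventually.of_forall fun _ => one_ne_zero)
    (fun i hi j hj k => by
      rw [if_pos (by omega), hμ.moment hX k]
      simp)
    (fun η hη => hξ η fun k => hη 0 (by norm_num) k)
  exact_mod_cast h

-- Where the multiplicity is at least two, a single vector field `f` leaves a pointwise orthogonal
-- direction free, and a field in that direction is orthogonal to all `x ^ k f`.
omit [CompleteSpace H] in
theorem ae_le_one_of_isCyclicVector [IsFiniteMeasure μ] (hm : Measurable m)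
    (hU : UnitarilyEquivalentToMul X μ m) {ξ : H} (hξ : IsCyclicVector X ξ) :
    ∀ᵐ x ∂μ, m x ≤ 1 := by
  obtain ⟨U, hU⟩ := hU
  let f : Lp (Ell2 ℕ) 2 μ := U ξ
  let E : Set ℝ := {x | 2 ≤ m x}
  have hE : MeasurableSet E := hm (MeasurableSet.of_discrete (s := Set.Ici 2))
  have hzero : ∀ g : fieldL2 μ m, (∀ k : ℕ,
      inner ℂ (g : Lp (Ell2 ℕ) 2 μ) (U ((X ^ k) ξ) : Lp (Ell2 ℕ) 2 μ) = 0) → g = 0 := by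
    intro g hg
    have h1 : U.symm g = 0 := hξ _ fun k => by
      rw [inner_eq_zero_symm, ← U.inner_map_map, U.apply_symm_apply]
      exact hg k
    rwa [LinearIsometryEquiv.map_eq_zero_iff] at h1
  have hconj : ∀ j : ℕ, MemLp (fun x => (starRingEnd ℂ) (f x j)) 2 μ := fun j =>
    (memLp_coord f j).star
  -- The pair `(-conj f₁, conj f₀)` is pointwise orthogonal to `(f₀, f₁)`. By cyclicity it vanishes
  -- on `E`, so `f₀ = 0` there.
  have hφ0 : MemLp (E.indicator fun x => -(starRingEnd ℂ) (f x 1)) 2 μ := (hconj 1).neg.indicator hE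
  have hφ1 : MemLp (E.indicator fun x => (starRingEnd ℂ) (f x 0)) 2 μ := (hconj 0).indicator hE
  have hφ2 : MemLp (E.indicator fun _ : ℝ => (1 : ℂ)) 2 μ := (memLp_const 1).indicator hE
  have hmem : ∀ (j : ℕ) (φ : ℝ → ℂ) (hφ : MemLp (E.indicator φ) 2 μ), j < 2 →
      coordLp j _ hφ ∈ fieldL2 μ m := by
    intro j φ hφ hj
    refine coordLp_mem j hφ (Filter.Eventually.of_forall fun x hx => ?_)
    refine Set.indicator_of_notMem (fun hxE => ?_) _
    have h2 : (2 : ℕ∞) ≤ (j : ℕ∞) := le_trans hxE hx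
    have : 2 ≤ j := by exact_mod_cast h2
    omega
  let g : fieldL2 μ m := ⟨coordLp 0 _ hφ0, hmem 0 _ hφ0 (by norm_num)⟩
    + ⟨coordLp 1 _ hφ1, hmem 1 _ hφ1 (by norm_num)⟩
  have hg : g = 0 := by
    refine hzero g fun k => ?_
    rw [Submodule.coe_add, inner_add_left, inner_coordLp_model_pow hU, inner_coordLp_model_pow hU]
    refine add_eq_zero_iff_eq_neg.2 ?_
    rw [← integral_neg]
    refine integral_congr_ae (Filter.Eventually.of_forall fun x => ?_)
    by_cases hx : x ∈ E
    · simp only [Set.indicator_of_mem hx, map_neg, Complex.conj_conj, f]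
      ring
    · simp only [Set.indicator_of_notMem hx, map_zero, zero_mul, mul_zero, neg_zero]
  have hgx : ∀ᵐ x ∂μ, x ∈ E → f x 0 = 0 := by
    have h1 : (coordLp 0 _ hφ0 + coordLp 1 _ hφ1 : Lp (Ell2 ℕ) 2 μ) = 0 := congrArg Subtype.val hg
    have h2 := Lp.coeFn_add (coordLp 0 _ hφ0) (coordLp 1 _ hφ1)
    rw [h1] at h2
    filter_upwards [h2, coordLp_apply 0 hφ0, coordLp_apply 1 hφ1, Lp.coeFn_zero (Ell2 ℕ) 2 μ]
      with x e1 e2 e3 e4 hx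
    have e5 := congrArg (fun y : Ell2 ℕ => y 1) e1
    simp only [e4, Pi.add_apply, e2, e3, lp.coeFn_add, lp.coeFn_smul, Pi.smul_apply,
      delta_apply_self, delta_apply_ne (one_ne_zero : (1 : ℕ) ≠ 0), Set.indicator_of_mem hx] at e5
    have e6 : (starRingEnd ℂ) (f x 0) = 0 := by simpa using e5.symm
    exact (map_eq_zero _).1 e6
  -- Since `f₀ = 0` on `E`, the field equal to the basis vector `e₀` on `E` and to zero elsewhere is
  -- orthogonal to the cyclic subspace too; so it vanishes and `E` is null.
  have hg2 : (⟨coordLp 0 _ hφ2, hmem 0 _ hφ2 (by norm_num)⟩ : fieldL2 μ m) = 0 := by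
    refine hzero _ fun k => ?_
    rw [inner_coordLp_model_pow hU, ← integral_zero ℝ ℂ (μ := μ)]
    refine integral_congr_ae ?_
    filter_upwards [hgx] with x hx
    by_cases hxE : x ∈ E
    · have := hx hxE
      simp only [f] at this
      rw [this, mul_zero, mul_zero]
    · rw [Set.indicator_of_notMem hxE, map_zero, zero_mul, mul_zero]
  have h1 : (coordLp 0 _ hφ2 : Lp (Ell2 ℕ) 2 μ) = 0 := congrArg Subtype.val hg2
  have h2 := coordLp_apply 0 hφ2
  rw [h1] at h2
  filter_upwards [h2, Lp.coeFn_zero (Ell2 ℕ) 2 μ] with x e1 e2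
  by_contra hlt
  have hxE : x ∈ E := by
    rw [not_le] at hlt
    have := Order.add_one_le_of_lt hlt
    rwa [one_add_one_eq_two] at this
  have e3 := congrArg (fun y : Ell2 ℕ => y 0) e1
  simp only [e2, lp.coeFn_smul, Pi.smul_apply, delta_apply_self, Set.indicator_of_mem hxE] at e3
  simp at e3

/-- The constant function 1 in the only coordinate is cyclic, again because moments determine
integrable densities. -/
theorem exists_isCyclicVector_of_model [IsFiniteMeasure μ] (hμ : BoundedSupport μ)
    (hU : UnitarilyEquivalentToMul X μ m) (hX : IsSelfAdjoint X) (hm : ∀ᵐ x ∂μ, m x = 1) :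
    ∃ ξ, IsCyclicVector X ξ := by
  obtain ⟨U, hU⟩ := hU
  have hφ : MemLp (fun _ : ℝ => (1 : ℂ)) 2 μ := memLp_const 1
  have hmem : coordLp 0 _ hφ ∈ fieldL2 μ m := by
    refine coordLp_mem 0 hφ ?_
    filter_upwards [hm] with x hx h
    rw [hx] at h
    simp at h
  refine ⟨U.symm ⟨_, hmem⟩, fun η hη => ?_⟩
  have h1 := ae_eq_zero_of_moments hμ ((memLp_coord (U η) 0).integrable one_le_two)
    (fun k => by
      have h := hη k
      rw [inner_pow_apply_left hX, ← U.inner_map_map, U.apply_symm_apply, Submodule.coe_inner,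
        inner_coordLp_model_pow hU] at h
      simpa using h)
  rw [← U.map_eq_zero_iff]
  refine fieldL2_eq_of_coord _ _ fun j => ?_
  filter_upwards [h1, hm, Lp.coeFn_zero (Ell2 ℕ) 2 μ] with x e1 e2 e3 hj
  rw [e2] at hj
  have : j = 0 := by
    have : j < 1 := by exact_mod_cast hj
    omega
  subst this
  rw [e1, Submodule.coe_zero, e3]
  rfl

-- For an eigenvector, `(x - z) (U η) x = 0` almost everywhere, so `U η` lives on the single point
-- `z.re`.
omit [CompleteSpace H] in
theorem exists_atom_of_hasSomeEigenvalue (hU : UnitarilyEquivalentToMul X μ m)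
    (h : HasSomeEigenvalue X) : ∃ x : ℝ, μ {x} ≠ 0 := by
  obtain ⟨U, hU⟩ := hU
  obtain ⟨z, hz⟩ := h
  obtain ⟨η, hη⟩ := hz.exists_hasEigenvector
  have hη1 : X η = z • η := hη.apply_eq_smul
  by_contra! hna
  refine hη.2 ?_
  rw [← U.map_eq_zero_iff]
  refine Subtype.ext (Lp.ext ?_)
  have h1 : ∀ᵐ x ∂μ, x ≠ z.re := by
    have := measure_eq_zero_iff_ae_notMem.1 (hna z.re)
    simpa using this
  have h2 := hU η
  rw [hη1, map_smul, Submodule.coe_smul] at h2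
  filter_upwards [h1, h2, Lp.coeFn_smul z (U η : Lp (Ell2 ℕ) 2 μ), Lp.coeFn_zero (Ell2 ℕ) 2 μ]
    with x e1 e2 e3 e4
  rw [Submodule.coe_zero, e4, Pi.zero_apply]
  rw [e3, Pi.smul_apply, ← sub_eq_zero, ← sub_smul, smul_eq_zero] at e2
  refine e2.resolve_left fun h => e1 ?_
  rw [sub_eq_zero.1 h, Complex.ofReal_re]

omit [CompleteSpace H] in
theorem hasSomeEigenvalue_of_atom [IsFiniteMeasure μ] (hU : UnitarilyEquivalentToMul X μ m)
    {x₀ : ℝ} (hx₀ : μ {x₀} ≠ 0) (hm : 1 ≤ m x₀) : HasSomeEigenvalue X := by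
  obtain ⟨U, hU⟩ := hU
  have hφ : MemLp (Set.indicator {x₀} fun _ : ℝ => (1 : ℂ)) 2 μ :=
    (memLp_const 1).indicator (measurableSet_singleton x₀)
  have hmem : coordLp 0 _ hφ ∈ fieldL2 μ m := by
    refine coordLp_mem 0 hφ (Filter.Eventually.of_forall fun x hx => ?_)
    refine Set.indicator_of_notMem (fun h => ?_) _
    rw [Set.mem_singleton_iff.1 h] at hx
    have := hm.trans hx
    simp at this
  let g : fieldL2 μ m := ⟨_, hmem⟩
  have hgx := coordLp_apply 0 hφ
  refine ⟨x₀, Module.End.hasEigenvalue_of_hasEigenvector (x := U.symm g) ⟨?_, ?_⟩⟩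
  · rw [Module.End.mem_eigenspace_iff]
    change X (U.symm g) = (x₀ : ℂ) • U.symm g
    apply U.injective
    rw [map_smul, U.apply_symm_apply]
    refine Subtype.ext (Lp.ext ?_)
    have h1 := hU (U.symm g)
    rw [U.apply_symm_apply] at h1
    rw [Submodule.coe_smul]
    filter_upwards [h1, hgx, Lp.coeFn_smul (x₀ : ℂ) (g : Lp (Ell2 ℕ) 2 μ)] with x e1 e2 e3
    rw [e1, e3, Pi.smul_apply]
    simp only [g]
    rw [e2]
    by_cases hx : x = x₀
    · rw [hx]
    · rw [Set.indicator_of_notMem (by simpa using hx), zero_smul, smul_zero, smul_zero]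
  · intro h
    rw [LinearIsometryEquiv.map_eq_zero_iff] at h
    have h1 : (coordLp 0 _ hφ : Lp (Ell2 ℕ) 2 μ) = 0 := congrArg Subtype.val h
    rw [h1] at hgx
    apply hx₀
    rw [measure_eq_zero_iff_ae_notMem]
    filter_upwards [hgx, Lp.coeFn_zero (Ell2 ℕ) 2 μ] with x e1 e2 hx
    have e3 := congrArg (fun y : Ell2 ℕ => y 0) e1
    simp only [e2, lp.coeFn_smul, Pi.smul_apply, delta_apply_self, Set.indicator_of_mem hx] at e3
    simp at e3

/-- No model of the whole operator is needed: `L²(μ)` embeds isometrically in the cyclic subspace of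
`ξ`, and the indicator function of the atom is sent to an eigenvector. This makes the statement
available for the line before its multiplicity is known. -/
theorem IsLocalSpectralMeasure.hasSomeEigenvalue_of_atom (hX : IsSelfAdjoint X) {ξ : H}
    (hξ : IsLocalSpectralMeasure X ξ μ) {x₀ : ℝ} (hx₀ : μ {x₀} ≠ 0) : HasSomeEigenvalue X := by
  have := hξ.finite
  have hμ := hξ.boundedSupport
  have hφ : ∀ k : ℕ, MemLp (fun x : ℝ => (x : ℂ) ^ k) 2 μ := fun k => hμ.memLp (by fun_prop) 2
  let a : ℕ → Lp ℂ 2 μ := fun k => (hφ k).toLp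
  let b : ℕ → H := fun k => (X ^ k) ξ
  have ha : ∀ k f, inner ℂ (a k) f = ∫ x, (x : ℂ) ^ k * f x ∂μ := by
    intro k f
    rw [L2.inner_def]
    refine integral_congr_ae ?_
    filter_upwards [(hφ k).coeFn_toLp] with x hx
    simp only [a]
    rw [hx, RCLike.inner_apply, map_pow, Complex.conj_ofReal, mul_comm]
  have hab : ∀ k l, inner ℂ (a k) (a l) = inner ℂ (b k) (b l) := by
    intro k l
    simp only [b]
    rw [inner_pow_apply_pow_apply hX, hξ.moment hX, ha, ← integral_complex_ofReal]
    refine integral_congr_ae ?_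
    filter_upwards [(hφ l).coeFn_toLp] with x hx
    simp only [a]
    rw [hx, pow_add]
    push_cast
    rfl
  have htot : ∀ f, (∀ k, inner ℂ (a k) f = 0) → f = 0 := by
    intro f hf
    have h1 := ae_eq_zero_of_moments hμ ((Lp.memLp f).integrable one_le_two)
      (fun k => by rw [← ha, hf])
    refine Lp.ext ?_
    filter_upwards [h1, Lp.coeFn_zero ℂ 2 μ] with x e1 e2
    rw [e1, e2]
    rfl
  obtain ⟨W, hW⟩ := exists_linearIsometry_of_gram hab htot
  have hψ : MemLp (Set.indicator {x₀} fun _ : ℝ => (1 : ℂ)) 2 μ :=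
    (memLp_const 1).indicator (measurableSet_singleton x₀)
  let g : Lp ℂ 2 μ := hψ.toLp
  have hgx := hψ.coeFn_toLp
  have hg0 : g ≠ 0 := by
    intro h
    apply hx₀
    rw [measure_eq_zero_iff_ae_notMem]
    simp only [g] at h
    rw [h] at hgx
    filter_upwards [hgx, Lp.coeFn_zero ℂ 2 μ] with x e1 e2 hx
    rw [e2, Set.indicator_of_mem hx] at e1
    simp at e1
  have hmoment : ∀ k, inner ℂ (b k) (X (W g) - (x₀ : ℂ) • W g) = 0 := by
    intro k
    have e1 : inner ℂ (b k) (X (W g)) = inner ℂ (b (k + 1)) (W g) := by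
      simp only [b]
      rw [inner_pow_apply_left hX, inner_pow_apply_left hX, pow_succ]
      rfl
    rw [inner_sub_right, e1, inner_smul_right, ← hW, ← hW, W.inner_map_map, W.inner_map_map, ha,
      ha, ← integral_const_mul, sub_eq_zero]
    refine integral_congr_ae ?_
    filter_upwards [hgx] with x hx
    simp only [g]
    rw [hx]
    by_cases hxx : x = x₀
    · rw [hxx, pow_succ]
      ring
    · rw [Set.indicator_of_notMem (by simpa using hxx), mul_zero, mul_zero, mul_zero]
  let M := (Submodule.span ℂ (Set.range b)).topologicalClosure
  have hWM : W g ∈ M := by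
    have h1 : g ∈ closure (Submodule.span ℂ (Set.range a) : Set (Lp ℂ 2 μ)) := by
      rw [← Submodule.topologicalClosure_coe, topologicalClosure_span_eq_top htot]
      trivial
    refine map_mem_closure W.continuous h1 fun y hy => ?_
    induction hy using Submodule.span_induction with
    | mem y hy =>
      obtain ⟨k, rfl⟩ := hy
      rw [hW]
      exact Submodule.subset_span ⟨k, rfl⟩
    | zero => simp
    | add y z _ _ h1 h2 =>
      rw [map_add]
      exact Submodule.add_mem _ h1 h2
    | smul c y _ h =>
      rw [map_smul]
      exact Submodule.smul_mem _ c h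
  have hXM : X (W g) ∈ M := by
    refine map_mem_closure X.continuous hWM fun y hy => ?_
    induction hy using Submodule.span_induction with
    | mem y hy =>
      obtain ⟨k, rfl⟩ := hy
      refine Submodule.subset_span ⟨k + 1, ?_⟩
      simp only [b, pow_succ']
      rfl
    | zero => simp
    | add y z _ _ h1 h2 =>
      rw [map_add]
      exact Submodule.add_mem _ h1 h2
    | smul c y _ h =>
      rw [map_smul]
      exact Submodule.smul_mem _ c h
  have hperp : X (W g) - (x₀ : ℂ) • W g ∈ Mᗮ := by
    rw [Submodule.orthogonal_closure, Submodule.mem_orthogonal]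
    intro y hy
    induction hy using Submodule.span_induction with
    | mem y hy =>
      obtain ⟨k, rfl⟩ := hy
      exact hmoment k
    | zero => exact inner_zero_left _
    | add y z _ _ h1 h2 => rw [inner_add_left, h1, h2, add_zero]
    | smul c y _ h => rw [inner_smul_left, h, mul_zero]
  -- The defect lies in the closed cyclic subspace and is orthogonal to it.
  have hzero : X (W g) - (x₀ : ℂ) • W g = 0 := by
    have := (Submodule.mem_orthogonal _ _).1 hperp _
      (M.sub_mem hXM (M.smul_mem (x₀ : ℂ) hWM))
    exact inner_self_eq_zero.1 this
  refine ⟨x₀, Module.End.hasEigenvalue_of_hasEigenvector (x := W g) ⟨?_, ?_⟩⟩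
  · rw [Module.End.mem_eigenspace_iff]
    exact sub_eq_zero.1 hzero
  · rwa [Ne, ← W.toLinearMap.map_zero, LinearIsometry.coe_toLinearMap, W.injective.eq_iff]

end Models

/-! ### Invariants of the marked spectrum -/

section Invariants

universe v

variable {H : Type u} [NormedAddCommGroup H] [InnerProductSpace ℂ H] [CompleteSpace H]
variable {K : Type v} [NormedAddCommGroup K] [InnerProductSpace ℂ K] [CompleteSpace K]
variable {X : H →L[ℂ] H} {Y : K →L[ℂ] K}

theorem IsScalarSpectralMeasure.isFiniteMeasure {μ : Measure ℝ} (h : IsScalarSpectralMeasure X μ) :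
    IsFiniteMeasure μ := by
  obtain ⟨ξ, -, hξ⟩ := h
  exact hξ.finite

theorem IsScalarSpectralMeasure.boundedSupport {μ : Measure ℝ} (h : IsScalarSpectralMeasure X μ) :
    BoundedSupport μ := by
  obtain ⟨ξ, -, hξ⟩ := h
  exact hξ.boundedSupport

theorem IsScalarSpectralMeasure.ae_mem_spectrum {μ : Measure ℝ}
    (h : IsScalarSpectralMeasure X μ) : ∀ᵐ x ∂μ, x ∈ spectrum ℝ X := by
  obtain ⟨ξ, -, hξ⟩ := h
  exact mem_ae_iff.2 hξ.carried

theorem SameMarkedSpectrum.symm (h : SameMarkedSpectrum X Y) : SameMarkedSpectrum Y X := by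
  obtain ⟨S, μ, ν, m, n, h1, h2, h3, h4, h5⟩ := h
  exact ⟨S, ν, μ, n, m, h2, h1, h4, h3, Filter.EventuallyEq.symm (h4.ae_le h5)⟩

theorem SameMarkedSpectrum.hasSomeEigenvalue (h : SameMarkedSpectrum X Y)
    (hX : HasSomeEigenvalue X) : HasSomeEigenvalue Y := by
  obtain ⟨S, μ, ν, m, n, h1, h2, h3, h4, h5⟩ := h
  have := h2.scalar.isFiniteMeasure
  obtain ⟨x, hx⟩ := exists_atom_of_hasSomeEigenvalue h1.unitary hX
  have hx' : ν {x} ≠ 0 := fun h => hx (h3 h)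
  -- The bound on the multiplicity is known on the spectrum only, but an atom must lie there.
  refine hasSomeEigenvalue_of_atom h2.unitary hx' (h2.one_le x ?_)
  by_contra hxs
  refine hx' (measure_mono_null ?_ (mem_ae_iff.1 h2.scalar.ae_mem_spectrum))
  rintro _ rfl
  exact hxs

theorem SameMarkedSpectrum.exists_isCyclicVector (hYsa : IsSelfAdjoint Y)
    (h : SameMarkedSpectrum X Y) {ξ : H} (hX : IsCyclicVector X ξ) :
    ∃ η, IsCyclicVector Y η := by
  obtain ⟨S, μ, ν, m, n, h1, h2, h3, h4, h5⟩ := h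
  have := h1.scalar.isFiniteMeasure
  have := h2.scalar.isFiniteMeasure
  have hm : ∀ᵐ x ∂μ, n x = 1 := by
    filter_upwards [ae_le_one_of_isCyclicVector h1.measurable h1.unitary hX,
      h1.scalar.ae_mem_spectrum, h5] with x e1 e2 e3
    rw [← e3]
    exact le_antisymm e1 (h1.one_le x e2)
  exact exists_isCyclicVector_of_model h2.scalar.boundedSupport h2.unitary hYsa (h4.ae_le hm)

/-- A cyclic vector would make the multiplicity both greater than one and at most one almost
everywhere, so the measure, and with it the whole space, would be zero; `η₀` excludes this. -/
theorem HasUniformMultiplicity.not_isCyclicVector {n : ℕ∞} (h : HasUniformMultiplicity X n)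
    (hn : 1 < n) {η₀ : H} (hη₀ : η₀ ≠ 0) (ξ : H) : ¬ IsCyclicVector X ξ := by
  intro hξ
  obtain ⟨μ, m, h1, h2⟩ := h
  have := h1.scalar.isFiniteMeasure
  have h3 := ae_le_one_of_isCyclicVector h1.measurable h1.unitary hξ
  have h4 : ∀ᵐ _ ∂μ, False := by
    filter_upwards [h2, h3] with x e1 e2
    rw [e1] at e2
    exact absurd hn (not_lt.2 e2)
  obtain ⟨U, -⟩ := h1.unitary
  refine hη₀ ?_
  rw [← U.map_eq_zero_iff]
  refine Subtype.ext (Lp.ext ?_)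
  filter_upwards [h4] with x hx
  exact hx.elim

end Invariants

/-! ### The spectrum of a graph which contains a tail -/

section Tail

variable {V : Type u}

theorem orthonormal_delta : Orthonormal ℂ (delta : V → Ell2 V) := by
  refine ⟨norm_delta, fun u v huv => ?_⟩
  change inner ℂ (delta u) (delta v) = 0
  rw [inner_delta]
  exact delta_apply_ne huv

/-- The powers of `z` solve the eigenvalue equation for `z + z⁻¹` inside the tail, so truncation
leaves only boundary terms, two at each end. -/
theorem adjacencyOperator_sum_tail {G : SimpleGraph V} (hG : BoundedDegree G) {q : ℕ → V}
    (hadj : ∀ n, adjacencyOperator G hG (delta (q (n + 1))) = delta (q n) + delta (q (n + 2)))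
    {z w : ℂ} (hzw : z * w = 1) (N : ℕ) :
    adjacencyOperator G hG (∑ j ∈ Finset.range N, z ^ j • delta (q (j + 1)))
      - (z + w) • ∑ j ∈ Finset.range N, z ^ j • delta (q (j + 1))
      = delta (q 0) - w • delta (q 1) - z ^ N • delta (q N) + (z ^ N * w) • delta (q (N + 1)) := by
  induction N with
  | zero => simp
  | succ N ih =>
    have h1 : z ^ (N + 1) * w = z ^ N := by rw [pow_succ, mul_assoc, hzw, mul_one]
    rw [Finset.sum_range_succ, map_add, smul_add, add_sub_add_comm, ih, map_smul, hadj, h1]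
    module

theorem norm_adjacencyOperator_sum_tail_le {G : SimpleGraph V} (hG : BoundedDegree G) {q : ℕ → V}
    (hadj : ∀ n, adjacencyOperator G hG (delta (q (n + 1))) = delta (q n) + delta (q (n + 2)))
    {z w : ℂ} (hzw : z * w = 1) (hz : ‖z‖ = 1) (N : ℕ) :
    ‖adjacencyOperator G hG (∑ j ∈ Finset.range N, z ^ j • delta (q (j + 1)))
      - (z + w) • ∑ j ∈ Finset.range N, z ^ j • delta (q (j + 1))‖ ≤ 4 := by
  have hw : ‖w‖ = 1 := by
    have := congrArg norm hzw
    rwa [norm_mul, hz, one_mul, norm_one] at this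
  rw [adjacencyOperator_sum_tail hG hadj hzw]
  refine (norm_add_le_of_le (norm_sub_le_of_le (norm_sub_le_of_le (r₁ := 1) (r₂ := 1) ?_ ?_)
    (r₂ := 1) ?_) (r₂ := 1) ?_).trans (by norm_num)
  all_goals simp [norm_smul, norm_delta, hz, hw]

theorem norm_sq_sum_tail {q : ℕ → V} (hq : Function.Injective q) {z : ℂ} (hz : ‖z‖ = 1) (N : ℕ) :
    ‖∑ j ∈ Finset.range N, z ^ j • delta (q (j + 1))‖ ^ 2 = N := by
  have ho : Orthonormal ℂ (fun j => delta (q (j + 1))) :=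
    orthonormal_delta.comp _ fun i j h => by simpa using hq h
  have h := ho.inner_sum (fun j => z ^ j) (fun j => z ^ j) (Finset.range N)
  rw [inner_self_eq_norm_sq_to_K] at h
  have h1 : ∀ j, (starRingEnd ℂ) (z ^ j) * z ^ j = 1 := by
    intro j
    rw [← Complex.normSq_eq_conj_mul_self, Complex.normSq_eq_norm_sq, norm_pow, hz]
    simp
  simp only [h1, Finset.sum_const, Finset.card_range, nsmul_eq_mul, mul_one] at h
  refine Complex.ofReal_injective ?_
  push_cast
  exact h

/-- Write `x = 2 cos θ = z + z⁻¹` with `|z| = 1`. The truncated waves have norm `√N` and a defect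
bounded by 4 uniformly in `N`, which a bounded inverse would forbid. -/
theorem mem_spectrum_of_tail {G : SimpleGraph V} (hG : BoundedDegree G) {q : ℕ → V}
    (hq : Function.Injective q)
    (hadj : ∀ n, adjacencyOperator G hG (delta (q (n + 1))) = delta (q n) + delta (q (n + 2)))
    {x : ℝ} (hx : x ∈ Set.Icc (-2 : ℝ) 2) : (x : ℂ) ∈ spectrum ℂ (adjacencyOperator G hG) := by
  set θ := Real.arccos (x / 2) with hθ
  have hcos : Real.cos θ = x / 2 := Real.cos_arccos (by linarith [hx.1]) (by linarith [hx.2])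
  set z := Complex.exp (θ * Complex.I) with hz
  set w := Complex.exp (-θ * Complex.I) with hw
  have hzw : z * w = 1 := by
    rw [hz, hw, ← Complex.exp_add, neg_mul, add_neg_cancel, Complex.exp_zero]
  have hznorm : ‖z‖ = 1 := Complex.norm_exp_ofReal_mul_I θ
  have hsum : z + w = x := by
    have h1 : z + w = 2 * Complex.cos θ := (Complex.two_cos (θ : ℂ)).symm
    rw [h1, ← Complex.ofReal_cos, hcos]
    push_cast
    ring
  by_contra hns
  rw [spectrum.notMem_iff] at hns
  obtain ⟨T, hT⟩ := hns
  set B : Ell2 V →L[ℂ] Ell2 V := ↑T⁻¹ with hB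
  have hBT : B * (algebraMap ℂ _ (x : ℂ) - adjacencyOperator G hG) = 1 := by
    rw [← hT, hB, Units.inv_mul]
  have hbound : ∀ N : ℕ, (N : ℝ) ≤ (‖B‖ * 4) ^ 2 := by
    intro N
    set ξ := ∑ j ∈ Finset.range N, z ^ j • delta (q (j + 1)) with hξ
    have h1 : ξ = B ((algebraMap ℂ (Ell2 V →L[ℂ] Ell2 V) (x : ℂ) - adjacencyOperator G hG) ξ) := by
      have := congrArg (fun S : Ell2 V →L[ℂ] Ell2 V => S ξ) hBT
      exact this.symm
    have h2 : ‖(algebraMap ℂ (Ell2 V →L[ℂ] Ell2 V) (x : ℂ) - adjacencyOperator G hG) ξ‖ ≤ 4 := by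
      rw [Algebra.algebraMap_eq_smul_one, sub_apply, smul_apply, one_apply_eq_self, norm_sub_rev,
        ← hsum]
      exact norm_adjacencyOperator_sum_tail_le hG hadj hzw hznorm N
    have h3 : ‖ξ‖ ≤ ‖B‖ * 4 := by
      rw [h1]
      exact (B.le_opNorm _).trans (by gcongr)
    rw [← norm_sq_sum_tail hq hznorm N]
    gcongr
  obtain ⟨N, hN⟩ := exists_nat_gt ((‖B‖ * 4) ^ 2)
  exact absurd (hbound N) (not_le.2 hN)

theorem norm_le_of_mem_spectrum {H : Type*} [NormedAddCommGroup H] [InnerProductSpace ℂ H]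
    [CompleteSpace H] {X : H →L[ℂ] H} {z : ℂ} (hz : z ∈ spectrum ℂ X) : ‖z‖ ≤ ‖X‖ := by
  refine (spectrum.norm_le_norm_mul_of_mem hz).trans ?_
  exact mul_le_of_le_one_right (norm_nonneg _) ContinuousLinearMap.norm_id_le

theorem spectrum_eq_of_tail {G : SimpleGraph V} (hG : BoundedDegree G) {q : ℕ → V}
    (hq : Function.Injective q)
    (hadj : ∀ n, adjacencyOperator G hG (delta (q (n + 1))) = delta (q n) + delta (q (n + 2)))
    (hA : ‖adjacencyOperator G hG‖ ≤ 2) :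
    spectrum ℂ (adjacencyOperator G hG) = (fun x : ℝ => (x : ℂ)) '' Set.Icc (-2 : ℝ) 2 := by
  refine Set.Subset.antisymm (fun z hz => ?_) ?_
  · have h1 := (isSelfAdjoint_adjacencyOperator hG).mem_spectrum_eq_re hz
    have h2 := (Complex.abs_re_le_norm z).trans ((norm_le_of_mem_spectrum hz).trans hA)
    exact ⟨z.re, abs_le.1 h2, h1.symm⟩
  · rintro _ ⟨x, hx, rfl⟩
    exact mem_spectrum_of_tail hG hq hadj hx

theorem norm_eq_two_of_tail {G : SimpleGraph V} (hG : BoundedDegree G) {q : ℕ → V}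
    (hq : Function.Injective q)
    (hadj : ∀ n, adjacencyOperator G hG (delta (q (n + 1))) = delta (q n) + delta (q (n + 2)))
    (hA : ‖adjacencyOperator G hG‖ ≤ 2) : ‖adjacencyOperator G hG‖ = 2 := by
  refine le_antisymm hA ?_
  have h := norm_le_of_mem_spectrum
    (mem_spectrum_of_tail hG hq hadj (x := 2) (by constructor <;> norm_num))
  simpa using h

/-- A sequence which satisfies the eigenvalue equation on the ray and tends to zero vanishes. -/
theorem eq_zero_of_recurrence {x : ℕ → ℂ} {c : ℂ} (hx : Filter.Tendsto x Filter.atTop (nhds 0))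
    (h1 : x 1 = c * x 0) (h2 : ∀ n, x (n + 2) = c * x (n + 1) - x n) : ∀ n, x n = 0 := by
  -- This quadratic form is conserved by the recurrence and tends to zero with `x`. No distinction
  -- between values of `c` is needed.
  have hQ : ∀ n, x (n + 1) ^ 2 - c * x (n + 1) * x n + x n ^ 2 = x 0 ^ 2 := by
    intro n
    induction n with
    | zero =>
      rw [zero_add, h1]
      ring
    | succ n ih =>
      rw [← ih, h2]
      ring
  have hx' := (Filter.tendsto_add_atTop_iff_nat 1).2 hx
  have hlim : Filter.Tendsto (fun n => x (n + 1) ^ 2 - c * x (n + 1) * x n + x n ^ 2) Filter.atTop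
      (nhds (0 ^ 2 - c * 0 * 0 + 0 ^ 2)) :=
    ((hx'.pow 2).sub ((hx'.const_mul c).mul hx)).add (hx.pow 2)
  simp only [hQ] at hlim
  have h0 : x 0 = 0 := by
    have := tendsto_nhds_unique tendsto_const_nhds hlim
    simpa using this
  have h : ∀ n, x n = 0 ∧ x (n + 1) = 0 := by
    intro n
    induction n with
    | zero => exact ⟨h0, by rw [zero_add, h1, h0, mul_zero]⟩
    | succ n ih => exact ⟨ih.2, by rw [h2, ih.1, ih.2, mul_zero, sub_zero]⟩
  exact fun n => (h n).1

theorem tendsto_apply_atTop (ξ : Ell2 V) {q : ℕ → V} (hq : Function.Injective q) :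
    Filter.Tendsto (fun n => ξ (q n)) Filter.atTop (nhds 0) := by
  have := tendsto_apply_of_injective ξ hq
  rwa [Nat.cofinite_eq_atTop] at this

theorem adjacencyOperator_pow_succ_apply {G : SimpleGraph V} (hG : BoundedDegree G) (k : ℕ)
    (ξ : Ell2 V) :
    (adjacencyOperator G hG ^ (k + 1)) ξ
      = adjacencyOperator G hG ((adjacencyOperator G hG ^ k) ξ) := by
  rw [pow_succ']
  rfl

theorem inner_pow_delta {G : SimpleGraph V} (hG : BoundedDegree G) (k : ℕ) (v : V) (η : Ell2 V) :
    inner ℂ ((adjacencyOperator G hG ^ k) (delta v)) η = (adjacencyOperator G hG ^ k) η v := by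
  rw [inner_pow_apply_left (isSelfAdjoint_adjacencyOperator hG), inner_delta]

theorem exists_eq_smul_of_hasSomeEigenvalue {H : Type*} [NormedAddCommGroup H]
    [InnerProductSpace ℂ H] {X : H →L[ℂ] H} (h : HasSomeEigenvalue X) :
    ∃ (z : ℂ) (η : H), η ≠ 0 ∧ X η = z • η := by
  obtain ⟨z, hz⟩ := h
  obtain ⟨η, hη⟩ := hz.exists_hasEigenvector
  exact ⟨z, η, hη.2, hη.apply_eq_smul⟩

end Tail

/-! ### Graphs isomorphic to a given graph -/

section Iso

universe v

variable {V : Type u} {W : Type v} {G : SimpleGraph V} {Γ : SimpleGraph W}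

theorem iso_adj_symm_iff (e : G ≃g Γ) {x : W} {s : Finset W} (hs : ∀ y, Γ.Adj x y ↔ y ∈ s) (v : V) :
    G.Adj (e.symm x) v ↔ v ∈ s.map e.symm.toEquiv.toEmbedding := by
  rw [← e.map_adj_iff, e.apply_symm_apply, hs, Finset.mem_map_equiv]
  rfl

/-- Through `e.symm`, computations on `G` use the coordinates of `Γ`, without transporting operators
between Hilbert spaces. -/
theorem adjacencyOperator_apply_iso (hG : BoundedDegree G) (e : G ≃g Γ) {x : W} {s : Finset W}
    (hs : ∀ y, Γ.Adj x y ↔ y ∈ s) (ξ : Ell2 V) :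
    adjacencyOperator G hG ξ (e.symm x) = ∑ y ∈ s, ξ (e.symm y) := by
  rw [adjacencyOperator_apply_of_nb hG ξ _ _ (iso_adj_symm_iff e hs), Finset.sum_map]
  rfl

theorem adjacencyOperator_delta_iso (hG : BoundedDegree G) (e : G ≃g Γ) {x : W} {s : Finset W}
    (hs : ∀ y, Γ.Adj x y ↔ y ∈ s) :
    adjacencyOperator G hG (delta (e.symm x)) = ∑ y ∈ s, delta (e.symm y) := by
  rw [adjacencyOperator_delta_of_nb hG _ _ (iso_adj_symm_iff e hs), Finset.sum_map]
  rfl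

theorem ell2_eq_zero_of_iso (e : G ≃g Γ) {ξ : Ell2 V} (h : ∀ x, ξ (e.symm x) = 0) : ξ = 0 := by
  ext v
  have := h (e v)
  rwa [e.symm_apply_apply] at this

end Iso

/-! ### The infinite ray -/

section Ray

theorem infiniteRay_adj_zero (j : ℕ) : infiniteRay.Adj 0 j ↔ j ∈ ({1} : Finset ℕ) := by
  simp only [infiniteRay, SimpleGraph.fromRel_adj, Finset.mem_singleton]
  omega

theorem infiniteRay_adj_succ (n j : ℕ) :
    infiniteRay.Adj (n + 1) j ↔ j ∈ ({n, n + 2} : Finset ℕ) := by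
  simp only [infiniteRay, SimpleGraph.fromRel_adj, Finset.mem_singleton, Finset.mem_insert]
  omega

theorem norm_infiniteRay_le : ‖adjacencyOperator infiniteRay boundedDegree_infiniteRay‖ ≤ 2 := by
  refine norm_adjacencyOperator_le_two_of_weight _ (fun _ => 1) (fun _ => one_pos) fun u => ?_
  rcases u with _ | n
  · have : boundedDegree_infiniteRay.nb 0 = {1} := by
      ext j
      rw [BoundedDegree.mem_nb, infiniteRay_adj_zero]
    simp [this]
  · have : boundedDegree_infiniteRay.nb (n + 1) = {n, n + 2} := by
      ext j
      rw [BoundedDegree.mem_nb, infiniteRay_adj_succ]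
    rw [this, Finset.sum_pair (by omega)]
    norm_num

variable {V : Type u} {G : SimpleGraph V} (hG : BoundedDegree G) (e : G ≃g infiniteRay)

theorem ray_apply_zero (ξ : Ell2 V) :
    adjacencyOperator G hG ξ (e.symm 0) = ξ (e.symm 1) := by
  rw [adjacencyOperator_apply_iso hG e infiniteRay_adj_zero, Finset.sum_singleton]

theorem ray_apply_succ (ξ : Ell2 V) (n : ℕ) :
    adjacencyOperator G hG ξ (e.symm (n + 1)) = ξ (e.symm n) + ξ (e.symm (n + 2)) := by
  rw [adjacencyOperator_apply_iso hG e (infiniteRay_adj_succ n), Finset.sum_pair (by omega)]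

theorem ray_delta_succ (n : ℕ) :
    adjacencyOperator G hG (delta (e.symm (n + 1))) = delta (e.symm n) + delta (e.symm (n + 2)) := by
  rw [adjacencyOperator_delta_iso hG e (infiniteRay_adj_succ n), Finset.sum_pair (by omega)]

theorem ray_isCyclicVector : IsCyclicVector (adjacencyOperator G hG) (delta (e.symm 0)) := by
  intro η hη
  simp only [inner_pow_delta] at hη
  have h : ∀ n k, (adjacencyOperator G hG ^ k) η (e.symm n) = 0 ∧
      (adjacencyOperator G hG ^ k) η (e.symm (n + 1)) = 0 := by
    intro n
    induction n with
    | zero =>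
      intro k
      refine ⟨hη k, ?_⟩
      rw [zero_add, ← ray_apply_zero hG e, ← adjacencyOperator_pow_succ_apply]
      exact hη (k + 1)
    | succ n ih =>
      intro k
      refine ⟨(ih k).2, ?_⟩
      -- The equation at `n + 1` determines the coordinate at `n + 2`; carrying all powers `k` in
      -- the induction makes the left side known.
      have h1 := ray_apply_succ hG e ((adjacencyOperator G hG ^ k) η) n
      rw [← adjacencyOperator_pow_succ_apply, (ih (k + 1)).2, (ih k).1, zero_add] at h1
      exact h1.symm
  exact ell2_eq_zero_of_iso e fun n => by simpa using (h n 0).1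

include e in
theorem ray_not_hasSomeEigenvalue : ¬ HasSomeEigenvalue (adjacencyOperator G hG) := by
  intro h
  obtain ⟨z, η, hη, heq⟩ := exists_eq_smul_of_hasSomeEigenvalue h
  have hval : ∀ v, adjacencyOperator G hG η v = z * η v := by
    intro v
    rw [heq]
    rfl
  refine hη (ell2_eq_zero_of_iso e ?_)
  refine eq_zero_of_recurrence (c := z) (tendsto_apply_atTop η e.symm.injective) ?_ fun n => ?_
  · rw [← ray_apply_zero hG e, hval]
  · rw [← hval, ray_apply_succ]
    ring

end Ray

/-! ### The graph `D_∞` -/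

section DInfty

theorem dInfty_adj_none (j : Option ℕ) : dInfty.Adj none j ↔ j ∈ ({some 1} : Finset (Option ℕ)) := by
  rcases j with _ | j <;> simp [dInfty, dInftyRel]

theorem dInfty_adj_zero (j : Option ℕ) :
    dInfty.Adj (some 0) j ↔ j ∈ ({some 1} : Finset (Option ℕ)) := by
  rcases j with _ | j <;> simp [dInfty, dInftyRel]
  omega

theorem dInfty_adj_one (j : Option ℕ) :
    dInfty.Adj (some 1) j ↔ j ∈ ({some 0, none, some 2} : Finset (Option ℕ)) := by
  rcases j with _ | j <;> simp [dInfty, dInftyRel]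
  omega

theorem dInfty_adj_succ (n : ℕ) (j : Option ℕ) :
    dInfty.Adj (some (n + 2)) j ↔ j ∈ ({some (n + 1), some (n + 3)} : Finset (Option ℕ)) := by
  rcases j with _ | j <;> simp [dInfty, dInftyRel]
  omega

/-- The weight that is 1 at the two leaves and 2 elsewhere is harmonic, so Schur's test gives the
sharp constant. -/
theorem norm_dInfty_le : ‖adjacencyOperator dInfty boundedDegree_dInfty‖ ≤ 2 := by
  classical
  let h : Option ℕ → ℝ := fun i => if i = none ∨ i = some 0 then 1 else 2
  have h0 : h none = 1 := by simp [h]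
  have h1 : h (some 0) = 1 := by simp [h]
  have h2 : ∀ n, h (some (n + 1)) = 2 := fun n => by simp [h]
  refine norm_adjacencyOperator_le_two_of_weight _ h (fun i => ?_) fun u => ?_
  · simp only [h]
    split_ifs <;> norm_num
  · have hnb : ∀ (i : Option ℕ) (s : Finset (Option ℕ)), (∀ j, dInfty.Adj i j ↔ j ∈ s) →
        boundedDegree_dInfty.nb i = s := by
      intro i s hs
      ext j
      rw [BoundedDegree.mem_nb, hs]
    rcases u with _ | _ | _ | n
    · rw [hnb _ _ dInfty_adj_none, Finset.sum_singleton, h2 0, h0]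
      norm_num
    · rw [hnb _ _ dInfty_adj_zero, Finset.sum_singleton, h2 0, h1]
      norm_num
    · rw [hnb _ _ dInfty_adj_one, Finset.sum_insert (by simp), Finset.sum_pair (by simp), h0, h1,
        h2 0, h2 1]
      norm_num
    · rw [hnb _ _ (dInfty_adj_succ n), Finset.sum_pair (by simp), h2, h2, h2]
      norm_num

variable {V : Type u} {G : SimpleGraph V} (hG : BoundedDegree G) (e : G ≃g dInfty)

theorem dInfty_apply_none (ξ : Ell2 V) :
    adjacencyOperator G hG ξ (e.symm none) = ξ (e.symm (some 1)) := by
  rw [adjacencyOperator_apply_iso hG e dInfty_adj_none, Finset.sum_singleton]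

theorem dInfty_apply_zero (ξ : Ell2 V) :
    adjacencyOperator G hG ξ (e.symm (some 0)) = ξ (e.symm (some 1)) := by
  rw [adjacencyOperator_apply_iso hG e dInfty_adj_zero, Finset.sum_singleton]

theorem dInfty_apply_one (ξ : Ell2 V) :
    adjacencyOperator G hG ξ (e.symm (some 1))
      = ξ (e.symm (some 0)) + (ξ (e.symm none) + ξ (e.symm (some 2))) := by
  rw [adjacencyOperator_apply_iso hG e dInfty_adj_one, Finset.sum_insert (by simp),
    Finset.sum_pair (by simp)]

theorem dInfty_apply_succ (ξ : Ell2 V) (n : ℕ) :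
    adjacencyOperator G hG ξ (e.symm (some (n + 2)))
      = ξ (e.symm (some (n + 1))) + ξ (e.symm (some (n + 3))) := by
  rw [adjacencyOperator_apply_iso hG e (dInfty_adj_succ n), Finset.sum_pair (by simp)]

theorem dInfty_delta_succ (n : ℕ) :
    adjacencyOperator G hG (delta (e.symm (some (n + 1 + 1))))
      = delta (e.symm (some (n + 1))) + delta (e.symm (some (n + 2 + 1))) := by
  rw [adjacencyOperator_delta_iso hG e (dInfty_adj_succ n), Finset.sum_pair (by simp)]

-- The two leaves have the same unique neighbour, so the difference of their point masses is in the
-- kernel.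
include e in
theorem dInfty_hasSomeEigenvalue : HasSomeEigenvalue (adjacencyOperator G hG) := by
  refine ⟨0, Module.End.hasEigenvalue_of_hasEigenvector
    (x := delta (e.symm none) - delta (e.symm (some 0))) ⟨?_, ?_⟩⟩
  · rw [Module.End.mem_eigenspace_iff, zero_smul]
    change adjacencyOperator G hG _ = 0
    rw [map_sub, adjacencyOperator_delta_iso hG e dInfty_adj_none,
      adjacencyOperator_delta_iso hG e dInfty_adj_zero, sub_self]
  · intro h
    have h1 := congrArg (fun ξ : Ell2 V => ξ (e.symm none)) h
    simp only [lp.coeFn_sub, Pi.sub_apply, delta_apply_self] at h1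
    rw [delta_apply_ne (by simp)] at h1
    simp at h1

/-- Orthogonality to the cyclic subspace of one leaf kills the coordinates of all `A ^ k η` at that
leaf and its neighbour, but at the other leaf only for `k ≥ 1`. Propagation then gives `A η = 0`,
not yet `η = 0`. On the remaining ray `0', 1, 2, …` the vector `η` satisfies the recurrence with `c
= 0` and tends to zero. -/
theorem dInfty_isCyclicVector :
    IsCyclicVector (adjacencyOperator G hG) (delta (e.symm (some 0))) := by
  intro η hη
  simp only [inner_pow_delta] at hη
  set A := adjacencyOperator G hG with hA
  have hone : ∀ k, (A ^ k) η (e.symm (some 1)) = 0 := by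
    intro k
    rw [← dInfty_apply_zero hG e, ← adjacencyOperator_pow_succ_apply]
    exact hη (k + 1)
  have hnone : ∀ k, (A ^ (k + 1)) η (e.symm none) = 0 := by
    intro k
    rw [adjacencyOperator_pow_succ_apply, dInfty_apply_none]
    exact hone k
  have hsome : ∀ n k, (A ^ (k + 1)) η (e.symm (some n)) = 0 ∧
      (A ^ (k + 1)) η (e.symm (some (n + 1))) = 0 := by
    intro n
    induction n with
    | zero => exact fun k => ⟨hη _, hone _⟩
    | succ n ih =>
      intro k
      refine ⟨(ih k).2, ?_⟩
      rcases n with _ | n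
      · have h1 := dInfty_apply_one hG e ((A ^ (k + 1)) η)
        rw [← adjacencyOperator_pow_succ_apply, ← hA, hone, hη, hnone, zero_add, zero_add] at h1
        exact h1.symm
      · have h1 := dInfty_apply_succ hG e ((A ^ (k + 1)) η) n
        rw [← adjacencyOperator_pow_succ_apply, ← hA, (ih (k + 1)).2, (ih k).1, zero_add] at h1
        exact h1.symm
  have hAη : A η = 0 := by
    refine ell2_eq_zero_of_iso e fun i => ?_
    rcases i with _ | n
    · simpa using hnone 0
    · simpa using (hsome n 0).1
  have h0 : η (e.symm (some 0)) = 0 := by simpa using hη 0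
  have hval : ∀ v, A η v = 0 := by
    intro v
    rw [hAη]
    rfl
  let i : ℕ → Option ℕ := fun n => Nat.casesOn n none fun k => some (k + 1)
  have hi : Function.Injective i := by
    rintro (_ | m) (_ | n) h
    · rfl
    · exact absurd h (by simp [i])
    · exact absurd h (by simp [i])
    · simpa [i] using h
  have hrec := eq_zero_of_recurrence (c := 0) (x := fun n => η (e.symm (i n)))
    (tendsto_apply_atTop η (e.symm.injective.comp hi))
    (by
      have := dInfty_apply_none hG e η
      rw [← hA, hval] at this
      simpa [i] using this.symm)
    (fun n => by
      rcases n with _ | n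
      · have := dInfty_apply_one hG e η
        rw [← hA, hval, h0, zero_add] at this
        simp only [i, zero_mul, zero_sub, zero_add]
        exact eq_neg_of_add_eq_zero_right this.symm
      · have := dInfty_apply_succ hG e η n
        rw [← hA, hval] at this
        simp only [i, zero_mul, zero_sub]
        exact eq_neg_of_add_eq_zero_right this.symm)
  refine ell2_eq_zero_of_iso e fun j => ?_
  rcases j with _ | _ | n
  · exact hrec 0
  · exact h0
  · exact hrec (n + 1)

end DInfty

/-! ### The infinite line -/

section Line

theorem infiniteLine_adj (n j : ℤ) :
    infiniteLine.Adj n j ↔ j ∈ ({n - 1, n + 1} : Finset ℤ) := by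
  simp only [infiniteLine, SimpleGraph.fromRel_adj, Finset.mem_singleton, Finset.mem_insert]
  omega

theorem norm_infiniteLine_le :
    ‖adjacencyOperator infiniteLine boundedDegree_infiniteLine‖ ≤ 2 := by
  refine norm_adjacencyOperator_le_two_of_weight _ (fun _ => 1) (fun _ => one_pos) fun n => ?_
  have : boundedDegree_infiniteLine.nb n = {n - 1, n + 1} := by
    ext j
    rw [BoundedDegree.mem_nb, infiniteLine_adj]
  rw [this, Finset.sum_pair (by omega)]
  norm_num

variable {V : Type u} {G : SimpleGraph V} (hG : BoundedDegree G) (e : G ≃g infiniteLine)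

theorem line_apply (ξ : Ell2 V) (n : ℤ) :
    adjacencyOperator G hG ξ (e.symm n) = ξ (e.symm (n - 1)) + ξ (e.symm (n + 1)) := by
  rw [adjacencyOperator_apply_iso hG e (infiniteLine_adj n), Finset.sum_pair (by omega)]

theorem line_delta (n : ℤ) :
    adjacencyOperator G hG (delta (e.symm n))
      = delta (e.symm (n - 1)) + delta (e.symm (n + 1)) := by
  rw [adjacencyOperator_delta_iso hG e (infiniteLine_adj n), Finset.sum_pair (by omega)]

theorem line_delta_natCast (n : ℕ) :
    adjacencyOperator G hG (delta (e.symm ((n + 1 : ℕ) : ℤ)))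
      = delta (e.symm (n : ℤ)) + delta (e.symm ((n + 2 : ℕ) : ℤ)) := by
  rw [line_delta]
  push_cast
  rw [show (n : ℤ) + 1 - 1 = n by ring, show (n : ℤ) + 1 + 1 = n + 2 by ring]

-- For each centre `c`, the antisymmetric part `η (c + n + 1) - η (c - n - 1)` solves the eigenvalue
-- equation on a ray, hence vanishes. Thus `η` has period two, and decay at infinity makes it zero.
include e in
theorem line_not_hasSomeEigenvalue : ¬ HasSomeEigenvalue (adjacencyOperator G hG) := by
  intro h
  obtain ⟨z, η, hη, heq⟩ := exists_eq_smul_of_hasSomeEigenvalue h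
  have hval : ∀ n : ℤ, η (e.symm (n - 1)) + η (e.symm (n + 1)) = z * η (e.symm n) := by
    intro n
    rw [← line_apply hG e, heq]
    rfl
  have hper : ∀ c : ℤ, η (e.symm (c + 1)) = η (e.symm (c - 1)) := by
    intro c
    have i1 : Function.Injective fun n : ℕ => e.symm (c + (n + 1)) := fun i j hij => by
      have := e.symm.injective hij
      omega
    have i2 : Function.Injective fun n : ℕ => e.symm (c - (n + 1)) := fun i j hij => by
      have := e.symm.injective hij
      omega
    have hlim := (tendsto_apply_atTop η i1).sub (tendsto_apply_atTop η i2)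
    rw [sub_zero] at hlim
    have h0 := eq_zero_of_recurrence (c := z) hlim
      (by
        have h1 := hval (c + 1)
        have h2 := hval (c - 1)
        rw [show c + 1 - 1 = c by ring, show c + 1 + 1 = c + 2 by ring] at h1
        rw [show c - 1 - 1 = c - 2 by ring, show c - 1 + 1 = c by ring] at h2
        simp only [Nat.cast_one, Nat.cast_zero, zero_add, one_add_one_eq_two]
        linear_combination h1 - h2)
      (fun n => by
        have h1 := hval (c + (n + 2))
        have h2 := hval (c - (n + 2))
        rw [show c + ((n : ℤ) + 2) - 1 = c + (n + 1) by ring,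
          show c + ((n : ℤ) + 2) + 1 = c + (n + 3) by ring] at h1
        rw [show c - ((n : ℤ) + 2) - 1 = c - (n + 3) by ring,
          show c - ((n : ℤ) + 2) + 1 = c - (n + 1) by ring] at h2
        rw [show ((n + 2 : ℕ) : ℤ) + 1 = n + 3 by push_cast; ring,
          show ((n + 1 : ℕ) : ℤ) + 1 = n + 2 by push_cast; ring]
        linear_combination h1 - h2) 0
    simp only [Nat.cast_zero, zero_add] at h0
    exact sub_eq_zero.1 h0
  refine hη (ell2_eq_zero_of_iso e fun c => ?_)
  have hconst : ∀ n : ℕ, η (e.symm (c + 2 * n)) = η (e.symm c) := by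
    intro n
    induction n with
    | zero => simp
    | succ n ih =>
      have := hper (c + 2 * n + 1)
      rw [show c + 2 * (n : ℤ) + 1 + 1 = c + 2 * ((n + 1 : ℕ) : ℤ) by push_cast; ring,
        show c + 2 * (n : ℤ) + 1 - 1 = c + 2 * n by ring, ih] at this
      exact this
  have i1 : Function.Injective fun n : ℕ => e.symm (c + 2 * n) := fun i j hij => by
    have := e.symm.injective hij
    omega
  have hlim := tendsto_apply_atTop η i1
  simp only [hconst] at hlim
  exact tendsto_nhds_unique tendsto_const_nhds hlim

theorem line_pow_delta_neg (k : ℕ) (n : ℤ) :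
    (adjacencyOperator G hG ^ k) (delta (e.symm 0)) (e.symm (-n))
      = (adjacencyOperator G hG ^ k) (delta (e.symm 0)) (e.symm n) := by
  induction k generalizing n with
  | zero =>
    by_cases hn : n = 0
    · simp [hn]
    · rw [pow_zero, one_apply_eq_self, delta_apply_ne, delta_apply_ne]
      · exact fun h => hn (e.symm.injective h)
      · exact fun h => hn (neg_eq_zero.1 (e.symm.injective h))
  | succ k ih =>
    rw [adjacencyOperator_pow_succ_apply, line_apply, line_apply,
      show -n - 1 = -(n + 1) by ring, show -n + 1 = -(n - 1) by ring, ih, ih, add_comm]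

/-- The adjacency operator commutes with translations, which reduces the odd generator to translates
of the even one. -/
theorem line_pow_delta_sub_delta (k : ℕ) (n : ℤ) :
    (adjacencyOperator G hG ^ k) (delta (e.symm 1) - delta (e.symm (-1))) (e.symm n)
      = (adjacencyOperator G hG ^ k) (delta (e.symm 0)) (e.symm (n - 1))
        - (adjacencyOperator G hG ^ k) (delta (e.symm 0)) (e.symm (n + 1)) := by
  classical
  induction k generalizing n with
  | zero =>
    have hd : ∀ i j : ℤ, (delta (e.symm i) : V → ℂ) (e.symm j) = if j = i then 1 else 0 := by
      intro i j
      split_ifs with h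
      · rw [h, delta_apply_self]
      · exact delta_apply_ne fun h' => h (e.symm.injective h')
    simp only [pow_zero, one_apply_eq_self, lp.coeFn_sub, Pi.sub_apply, hd]
    congr 2
    · exact propext ⟨fun h => by omega, fun h => by omega⟩
    · exact propext ⟨fun h => by omega, fun h => by omega⟩
  | succ k ih =>
    simp only [adjacencyOperator_pow_succ_apply, line_apply hG e, ih,
      sub_add_cancel, add_sub_cancel_right]
    ring

/-- The equation at 0 says that the values at 1 and -1 add up to zero; being equal, both vanish. The
zeros then spread outwards in both directions. -/
theorem line_total {η : Ell2 V} (h0 : ∀ k, (adjacencyOperator G hG ^ k) η (e.symm 0) = 0)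
    (h1 : ∀ k, (adjacencyOperator G hG ^ k) η (e.symm 1)
      = (adjacencyOperator G hG ^ k) η (e.symm (-1))) : η = 0 := by
  have hstep : ∀ k n, (adjacencyOperator G hG ^ (k + 1)) η (e.symm n)
      = (adjacencyOperator G hG ^ k) η (e.symm (n - 1))
        + (adjacencyOperator G hG ^ k) η (e.symm (n + 1)) := by
    intro k n
    rw [adjacencyOperator_pow_succ_apply, line_apply]
  have hone : ∀ k, (adjacencyOperator G hG ^ k) η (e.symm (-1)) = 0 := by
    intro k
    have := hstep k 0
    rw [h0, zero_sub, zero_add, h1, ← two_mul] at this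
    simpa using this.symm
  have h : ∀ (n : ℕ) (k : ℕ), ((adjacencyOperator G hG ^ k) η (e.symm n) = 0 ∧
      (adjacencyOperator G hG ^ k) η (e.symm (-n)) = 0) ∧
      ((adjacencyOperator G hG ^ k) η (e.symm (n + 1)) = 0 ∧
      (adjacencyOperator G hG ^ k) η (e.symm (-(n + 1))) = 0) := by
    intro n
    induction n with
    | zero =>
      intro k
      simp only [Nat.cast_zero, neg_zero, zero_add]
      exact ⟨⟨h0 k, h0 k⟩, (h1 k).trans (hone k), hone k⟩
    | succ n ih =>
      intro k
      simp only [Nat.cast_add, Nat.cast_one]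
      refine ⟨(ih k).2, ?_, ?_⟩
      · have := hstep k (n + 1)
        rw [add_sub_cancel_right, (ih (k + 1)).2.1, (ih k).1.1, zero_add] at this
        exact this.symm
      · have := hstep k (-(n + 1))
        rw [show -((n : ℤ) + 1) + 1 = -n by ring, show -((n : ℤ) + 1) - 1 = -(n + 1 + 1) by ring,
          (ih (k + 1)).2.2, (ih k).1.2, add_zero] at this
        exact this.symm
  refine ell2_eq_zero_of_iso e fun n => ?_
  rcases Int.eq_nat_or_neg n with ⟨m, rfl | rfl⟩
  · simpa using (h m 0).1.1
  · simpa using (h m 0).1.2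

include e in
theorem line_hasUniformMultiplicity (hA : ‖adjacencyOperator G hG‖ ≤ 2) :
    HasUniformMultiplicity (adjacencyOperator G hG) 2 := by
  have hX := isSelfAdjoint_adjacencyOperator hG
  obtain ⟨μ, hμ⟩ := exists_isLocalSpectralMeasure hX (delta (e.symm 0))
  have hfin := hμ.finite
  have hatom : ∀ x : ℝ, μ {x} = 0 := by
    intro x
    by_contra h
    exact line_not_hasSomeEigenvalue hG e (hμ.hasSomeEigenvalue_of_atom hX h)
  have hspec : ∀ᵐ x ∂μ, |x| ≤ 2 := by
    filter_upwards [mem_ae_iff.2 hμ.carried] with x hx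
    have h1 : (x : ℂ) ∈ spectrum ℂ (adjacencyOperator G hG) := by
      simpa using spectrum.algebraMap_mem ℂ hx
    have h2 := (norm_le_of_mem_spectrum h1).trans hA
    rwa [Complex.norm_real] at h2
  have hne : ∀ x : ℝ, ∀ᵐ y ∂μ, y ≠ x := by
    intro x
    have := measure_eq_zero_iff_ae_notMem.1 (hatom x)
    simpa using this
  -- The square root of the density `4 - x²` of the second local measure. It vanishes within `[-2,
  -- 2]` only at `±2`, which are null points because the line has no eigenvalue.
  let s : ℕ → ℝ → ℝ := fun i x => if i = 0 then 1 else Real.sqrt (4 - x ^ 2)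
  let ξ : ℕ → Ell2 V := fun i => if i = 0 then delta (e.symm 0)
    else delta (e.symm 1) - delta (e.symm (-1))
  have hs1 : ∀ᵐ x ∂μ, s 1 x ^ 2 = 4 - x ^ 2 := by
    filter_upwards [hspec] with x hx
    refine Real.sq_sqrt ?_
    have := sq_le_sq' (neg_le_of_abs_le hx) (le_of_abs_le hx)
    linarith
  have hm := hμ.moment hX
  simp only [inner_delta] at hm
  have h2 : HasUniformMultiplicity (adjacencyOperator G hG) ((2 : ℕ) : ℕ∞) := by
    refine hasUniformMultiplicity_of_family hX 2 (by norm_num) ξ hμ s (fun i => ?_) (fun i => ?_)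
      ?_ ?_
    · by_cases hi : i = 0
      · simp only [s, hi, if_true]
        exact continuous_const
      · simp only [s, hi, if_false]
        fun_prop
    · by_cases hi : i = 0
      · exact Filter.Eventually.of_forall fun x => by simp [s, hi]
      · simp only [s, hi, if_false]
        filter_upwards [hspec, hne 2, hne (-2)] with x hx e1 e2
        refine (Real.sqrt_pos.2 ?_).ne'
        have hlt : |x| < 2 := lt_of_le_of_ne hx fun h => by
          rcases eq_or_eq_neg_of_abs_eq h with h | h
          · exact e1 h
          · exact e2 h
        have := sq_lt_sq' (neg_lt_of_abs_lt hlt) (lt_of_abs_lt hlt)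
        linarith
    · have h00 : ∀ k, inner ℂ (ξ 0) ((adjacencyOperator G hG ^ k) (ξ 0))
          = ((∫ x, s 0 x ^ 2 * x ^ k ∂μ : ℝ) : ℂ) := by
        intro k
        simp only [ξ, s, if_true, inner_delta, hm, one_pow, one_mul]
      have h01 : ∀ k, inner ℂ (ξ 0) ((adjacencyOperator G hG ^ k) (ξ 1)) = 0 := by
        intro k
        simp only [ξ, if_true, one_ne_zero, if_false, inner_delta]
        rw [line_pow_delta_sub_delta, zero_sub, zero_add, line_pow_delta_neg, sub_self]
      have h10 : ∀ k, inner ℂ (ξ 1) ((adjacencyOperator G hG ^ k) (ξ 0)) = 0 := by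
        intro k
        simp only [ξ, if_true, one_ne_zero, if_false, inner_sub_left, inner_delta]
        rw [line_pow_delta_neg, sub_self]
      have h11 : ∀ k, inner ℂ (ξ 1) ((adjacencyOperator G hG ^ k) (ξ 1))
          = ((∫ x, s 1 x ^ 2 * x ^ k ∂μ : ℝ) : ℂ) := by
        intro k
        -- With `c n` the coordinate of `A ^ k δ₀` at `n`, this is `4 c 0 - (2 c 0 + c 2 + c (-2))`,
        -- which is what expanding the odd generator gives.
        have hI : ∫ x, s 1 x ^ 2 * x ^ k ∂μ = 4 * ∫ x, x ^ k ∂μ - ∫ x, x ^ (k + 2) ∂μ := by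
          rw [← integral_const_mul, ← integral_sub]
          · refine integral_congr_ae ?_
            filter_upwards [hs1] with x hx
            rw [hx]
            ring
          · exact (hμ.boundedSupport.integrable (by fun_prop)).const_mul _
          · exact hμ.boundedSupport.integrable (by fun_prop)
        rw [hI]
        rw [Complex.ofReal_sub, Complex.ofReal_mul, Complex.ofReal_ofNat,
          ← hm k, ← hm (k + 2)]
        simp only [ξ, one_ne_zero, if_false, inner_sub_left, inner_delta]
        rw [line_pow_delta_sub_delta, line_pow_delta_sub_delta, adjacencyOperator_pow_succ_apply,
          line_apply, adjacencyOperator_pow_succ_apply, line_apply, line_apply,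
          show (1 : ℤ) - 1 = 0 by norm_num, show (0 : ℤ) + 1 - 1 = 0 by norm_num,
          show (0 : ℤ) - 1 + 1 = 0 by norm_num, show (-1 : ℤ) + 1 = 0 by norm_num,
          show (0 : ℤ) - 1 - 1 = -1 - 1 by norm_num, show (0 : ℤ) + 1 + 1 = 1 + 1 by norm_num]
        ring
      intro i hi j hj k
      interval_cases i <;> interval_cases j
      · rw [if_pos rfl, h00]
      · rw [if_neg (by norm_num), h01]
      · rw [if_neg (by norm_num), h10]
      · rw [if_pos rfl, h11]
    · intro η hη
      refine line_total hG e (fun k => ?_) fun k => ?_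
      · have := hη 0 (by norm_num) k
        rwa [inner_pow_apply_left hX, show ξ 0 = delta (e.symm 0) from rfl, inner_delta] at this
      · have := hη 1 (by norm_num) k
        rw [inner_pow_apply_left hX, show ξ 1 = delta (e.symm 1) - delta (e.symm (-1)) from rfl,
          inner_sub_left, inner_delta, inner_delta] at this
        exact sub_eq_zero.1 this
  exact_mod_cast h2

end Line

/-! ### Graphs with the spectrum of the line -/

section Spectrum

theorem norm_eq_two_and_spectrum_eq {V : Type u} {G : SimpleGraph V} (hG : BoundedDegree G)
    (hA : ‖adjacencyOperator G hG‖ ≤ 2) (h : Nonempty (G ≃g infiniteRay) ∨ Nonempty (G ≃g dInfty) ∨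
      Nonempty (G ≃g infiniteLine)) :
    ‖adjacencyOperator G hG‖ = 2 ∧
      spectrum ℂ (adjacencyOperator G hG) = (fun x : ℝ => (x : ℂ)) '' Set.Icc (-2 : ℝ) 2 := by
  rcases h with ⟨⟨e⟩⟩ | ⟨⟨e⟩⟩ | ⟨⟨e⟩⟩
  · exact ⟨norm_eq_two_of_tail hG e.symm.injective (ray_delta_succ hG e) hA,
      spectrum_eq_of_tail hG e.symm.injective (ray_delta_succ hG e) hA⟩
  · have hinj : Function.Injective fun n : ℕ => e.symm (some (n + 1)) := fun i j hij => by
      simpa using e.symm.injective hij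
    exact ⟨norm_eq_two_of_tail hG hinj (dInfty_delta_succ hG e) hA,
      spectrum_eq_of_tail hG hinj (dInfty_delta_succ hG e) hA⟩
  · have hinj : Function.Injective fun n : ℕ => e.symm (n : ℤ) := fun i j hij => by
      simpa using e.symm.injective hij
    exact ⟨norm_eq_two_of_tail hG hinj (line_delta_natCast hG e) hA,
      spectrum_eq_of_tail hG hinj (line_delta_natCast hG e) hA⟩

theorem finite_spectrum_adjacencyOperator {V : Type u} [Finite V] {G : SimpleGraph V}
    (hG : BoundedDegree G) : (spectrum ℂ (adjacencyOperator G hG)).Finite := by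
  have hfd : FiniteDimensional ℂ (Ell2 V) := by
    let f : Ell2 V →ₗ[ℂ] (V → ℂ) :=
      { toFun := fun ξ => ξ
        map_add' := fun _ _ => rfl
        map_smul' := fun _ _ => rfl }
    exact FiniteDimensional.of_injective f fun ξ η h => lp.ext h
  refine (Module.End.finite_hasEigenvalue
    (adjacencyOperator G hG : Ell2 V →ₗ[ℂ] Ell2 V)).subset fun z hz => ?_
  by_contra hne
  have hinj : Function.Injective
      ((algebraMap ℂ (Ell2 V →L[ℂ] Ell2 V) z - adjacencyOperator G hG :
        Ell2 V →L[ℂ] Ell2 V) : Ell2 V →ₗ[ℂ] Ell2 V) := by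
    rw [← LinearMap.ker_eq_bot, LinearMap.ker_eq_bot']
    intro ξ hξ
    by_contra h0
    refine hne (Module.End.hasEigenvalue_of_hasEigenvector (x := ξ) ⟨?_, h0⟩)
    rw [Module.End.mem_eigenspace_iff]
    have h1 : z • ξ - adjacencyOperator G hG ξ = 0 := hξ
    exact (sub_eq_zero.1 h1).symm
  refine (spectrum.mem_iff.1 hz) ?_
  rw [ContinuousLinearMap.isUnit_iff_bijective]
  exact ⟨hinj, LinearMap.injective_iff_surjective.1 hinj⟩

theorem infinite_image_Icc :
    ((fun x : ℝ => (x : ℂ)) '' Set.Icc (-2 : ℝ) 2).Infinite :=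
  (Set.Icc_infinite (by norm_num)).image Complex.ofReal_injective.injOn

/-- For a self-adjoint operator the norm is the spectral radius, so the marked spectrum controls the
norm. -/
theorem norm_le_two_of_spectrum {V : Type u} {G : SimpleGraph V} (hG : BoundedDegree G)
    (h : spectrum ℂ (adjacencyOperator G hG) = (fun x : ℝ => (x : ℂ)) '' Set.Icc (-2 : ℝ) 2) :
    ‖adjacencyOperator G hG‖ ≤ 2 := by
  have h1 : spectralRadius ℂ (adjacencyOperator G hG) ≤ ((2 : NNReal) : ℝ≥0∞) := by
    refine iSup₂_le fun z hz => ?_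
    rw [h] at hz
    obtain ⟨x, hx, rfl⟩ := hz
    have h2 : ‖(x : ℂ)‖₊ ≤ 2 := by
      rw [← NNReal.coe_le_coe, coe_nnnorm, Complex.norm_real, Real.norm_eq_abs]
      exact abs_le.2 hx
    exact ENNReal.coe_le_coe.2 h2
  rw [(isSelfAdjoint_adjacencyOperator hG).spectralRadius_eq_nnnorm] at h1
  have h2 : ‖adjacencyOperator G hG‖₊ ≤ 2 := by exact_mod_cast h1
  exact_mod_cast h2

/-- A connected graph with the marked spectrum of one of the three graphs is one of the three
graphs. -/
theorem classification_of_sameMarkedSpectrum {V : Type u} {Γ : SimpleGraph V}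
    (hΓ : BoundedDegree Γ) (hA : ‖adjacencyOperator Γ hΓ‖ ≤ 2)
    (h3 : Nonempty (Γ ≃g infiniteRay) ∨ Nonempty (Γ ≃g dInfty) ∨ Nonempty (Γ ≃g infiniteLine))
    {W : Type w} {G : SimpleGraph W} (hG : BoundedDegree G) (hc : G.Connected)
    (h : SameMarkedSpectrum (adjacencyOperator G hG) (adjacencyOperator Γ hΓ)) :
    Nonempty (G ≃g infiniteRay) ∨ Nonempty (G ≃g dInfty) ∨ Nonempty (G ≃g infiniteLine) := by
  have hspec : spectrum ℂ (adjacencyOperator G hG)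
      = (fun x : ℝ => (x : ℂ)) '' Set.Icc (-2 : ℝ) 2 := by
    obtain ⟨S, μ, ν, m, n, h1, h2, -⟩ := h
    rw [h1.spectrum_eq, ← h2.spectrum_eq, (norm_eq_two_and_spectrum_eq hΓ hA h3).2]
  have hinf : Infinite W := by
    by_contra hfin
    rw [not_infinite_iff_finite] at hfin
    exact infinite_image_Icc (hspec ▸ finite_spectrum_adjacencyOperator hG)
  exact classification_of_norm_le_two hG hc (norm_le_two_of_spectrum hG hspec)

theorem line_not_isCyclicVector {V : Type u} {G : SimpleGraph V} (hG : BoundedDegree G)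
    (e : G ≃g infiniteLine) (hA : ‖adjacencyOperator G hG‖ ≤ 2) (ξ : Ell2 V) :
    ¬ IsCyclicVector (adjacencyOperator G hG) ξ := by
  refine (line_hasUniformMultiplicity hG e hA).not_isCyclicVector (by norm_num)
    (η₀ := delta (e.symm 0)) (fun h => ?_) ξ
  have := norm_delta (e.symm 0)
  rw [h, norm_zero] at this
  exact zero_ne_one this

theorem norm_le_two_of_sameMarkedSpectrum {V : Type u} {Γ : SimpleGraph V}
    (hΓ : BoundedDegree Γ) (hA : ‖adjacencyOperator Γ hΓ‖ ≤ 2)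
    (h3 : Nonempty (Γ ≃g infiniteRay) ∨ Nonempty (Γ ≃g dInfty) ∨ Nonempty (Γ ≃g infiniteLine))
    {W : Type w} {G : SimpleGraph W} (hG : BoundedDegree G)
    (h : SameMarkedSpectrum (adjacencyOperator G hG) (adjacencyOperator Γ hΓ)) :
    ‖adjacencyOperator G hG‖ ≤ 2 := by
  obtain ⟨S, μ, ν, m, n, h1, h2, -⟩ := h
  refine norm_le_two_of_spectrum hG ?_
  rw [h1.spectrum_eq, ← h2.spectrum_eq, (norm_eq_two_and_spectrum_eq hΓ hA h3).2]

/-- Against `dInfty` the eigenvalue decides; against the line, a cyclic vector of the ray would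
carry over. -/
theorem determinedAmongConnected_infiniteRay :
    DeterminedAmongConnected.{0, w} infiniteRay boundedDegree_infiniteRay := by
  intro W G hG hc h
  have h3 : Nonempty (infiniteRay ≃g infiniteRay) ∨ Nonempty (infiniteRay ≃g dInfty) ∨
    Nonempty (infiniteRay ≃g infiniteLine) := Or.inl ⟨SimpleGraph.Iso.refl⟩
  have hA := norm_le_two_of_sameMarkedSpectrum _ norm_infiniteRay_le h3 hG h
  rcases classification_of_sameMarkedSpectrum _ norm_infiniteRay_le h3 hG hc h with
    he | ⟨⟨e⟩⟩ | ⟨⟨e⟩⟩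
  · exact he
  · exact absurd (h.hasSomeEigenvalue (dInfty_hasSomeEigenvalue hG e))
      (ray_not_hasSomeEigenvalue _ SimpleGraph.Iso.refl)
  · obtain ⟨ξ, hξ⟩ := h.symm.exists_isCyclicVector (isSelfAdjoint_adjacencyOperator hG)
      (ray_isCyclicVector boundedDegree_infiniteRay SimpleGraph.Iso.refl)
    exact absurd hξ (line_not_isCyclicVector hG e hA ξ)

/-- The eigenvalue alone separates it from both others. -/
theorem determinedAmongConnected_dInfty :
    DeterminedAmongConnected.{0, w} dInfty boundedDegree_dInfty := by
  intro W G hG hc h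
  have h3 : Nonempty (dInfty ≃g infiniteRay) ∨ Nonempty (dInfty ≃g dInfty) ∨
    Nonempty (dInfty ≃g infiniteLine) := Or.inr (Or.inl ⟨SimpleGraph.Iso.refl⟩)
  have hev := h.symm.hasSomeEigenvalue
    (dInfty_hasSomeEigenvalue boundedDegree_dInfty SimpleGraph.Iso.refl)
  rcases classification_of_sameMarkedSpectrum _ norm_dInfty_le h3 hG hc h with
    ⟨⟨e⟩⟩ | he | ⟨⟨e⟩⟩
  · exact absurd hev (ray_not_hasSomeEigenvalue hG e)
  · exact he
  · exact absurd hev (line_not_hasSomeEigenvalue hG e)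

theorem determinedAmongConnected_infiniteLine :
    DeterminedAmongConnected.{0, w} infiniteLine boundedDegree_infiniteLine := by
  intro W G hG hc h
  have h3 : Nonempty (infiniteLine ≃g infiniteRay) ∨ Nonempty (infiniteLine ≃g dInfty) ∨
    Nonempty (infiniteLine ≃g infiniteLine) := Or.inr (Or.inr ⟨SimpleGraph.Iso.refl⟩)
  rcases classification_of_sameMarkedSpectrum _ norm_infiniteLine_le h3 hG hc h with
    ⟨⟨e⟩⟩ | ⟨⟨e⟩⟩ | he
  · obtain ⟨ξ, hξ⟩ := h.exists_isCyclicVector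
      (isSelfAdjoint_adjacencyOperator boundedDegree_infiniteLine) (ray_isCyclicVector hG e)
    exact absurd hξ (line_not_isCyclicVector _ SimpleGraph.Iso.refl norm_infiniteLine_le ξ)
  · exact absurd (h.hasSomeEigenvalue (dInfty_hasSomeEigenvalue hG e))
      (line_not_hasSomeEigenvalue _ SimpleGraph.Iso.refl)
  · exact he

end Spectrum

end SpectralGraph

theorem mainTheorem6 :
    (∀ (V : Type u) [Infinite V] (G : SimpleGraph V) (hG : SpectralGraph.BoundedDegree G),
      G.Connected →
      ‖SpectralGraph.adjacencyOperator G hG‖ ≤ 2 →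
      ‖SpectralGraph.adjacencyOperator G hG‖ = 2 ∧
      spectrum ℂ (SpectralGraph.adjacencyOperator G hG)
        = (fun x : ℝ => (x : ℂ)) '' Set.Icc (-2 : ℝ) 2 ∧
      ((Nonempty (G ≃g SpectralGraph.infiniteRay) ∧
          SpectralGraph.IsMultiplicityFree (SpectralGraph.adjacencyOperator G hG) ∧
          ¬ SpectralGraph.HasSomeEigenvalue (SpectralGraph.adjacencyOperator G hG)) ∨
        (Nonempty (G ≃g SpectralGraph.dInfty) ∧
          SpectralGraph.IsMultiplicityFree (SpectralGraph.adjacencyOperator G hG) ∧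
          SpectralGraph.HasSomeEigenvalue (SpectralGraph.adjacencyOperator G hG)) ∨
        (Nonempty (G ≃g SpectralGraph.infiniteLine) ∧
          SpectralGraph.HasUniformMultiplicity (SpectralGraph.adjacencyOperator G hG) 2 ∧
          ¬ SpectralGraph.HasSomeEigenvalue (SpectralGraph.adjacencyOperator G hG)))) ∧
    SpectralGraph.DeterminedAmongConnected.{0, w}
      SpectralGraph.infiniteRay SpectralGraph.boundedDegree_infiniteRay ∧
    SpectralGraph.DeterminedAmongConnected.{0, w}
      SpectralGraph.dInfty SpectralGraph.boundedDegree_dInfty ∧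
    SpectralGraph.DeterminedAmongConnected.{0, w}
      SpectralGraph.infiniteLine SpectralGraph.boundedDegree_infiniteLine := by
  refine ⟨fun V _ G hG hc hA => ?_, SpectralGraph.determinedAmongConnected_infiniteRay,
    SpectralGraph.determinedAmongConnected_dInfty, SpectralGraph.determinedAmongConnected_infiniteLine⟩
  have h3 := SpectralGraph.classification_of_norm_le_two hG hc hA
  obtain ⟨h1, h2⟩ := SpectralGraph.norm_eq_two_and_spectrum_eq hG hA h3
  have hX := SpectralGraph.isSelfAdjoint_adjacencyOperator hG
  refine ⟨h1, h2, ?_⟩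
  rcases h3 with ⟨⟨e⟩⟩ | ⟨⟨e⟩⟩ | ⟨⟨e⟩⟩
  · exact Or.inl ⟨⟨e⟩, (SpectralGraph.ray_isCyclicVector hG e).isMultiplicityFree hX,
      SpectralGraph.ray_not_hasSomeEigenvalue hG e⟩
  · exact Or.inr (Or.inl ⟨⟨e⟩, (SpectralGraph.dInfty_isCyclicVector hG e).isMultiplicityFree hX,
      SpectralGraph.dInfty_hasSomeEigenvalue hG e⟩)
  · exact Or.inr (Or.inr ⟨⟨e⟩, SpectralGraph.line_hasUniformMultiplicity hG e hA,
      SpectralGraph.line_not_hasSomeEigenvalue hG e⟩)
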